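/- Let $H\subset\mathbb{P}^n$ be a complex projective hypersurface of degree $d$ (a nonzero homogeneous polynomial of degree $d$ up to scalars) with exactly one singular point $z$, and let $|H|$ be the linear system of all hypersurfaces of degree $d$ in $\mathbb{P}^n$. A deformation of a complex space germ $(X,x)$ over a germ $(B,b)$ consists of germ morphisms $(X,x)\overset{i}{\hookrightarrow}(\mathscr{X},x)\overset{\phi}{\to}(B,b)$ with $\phi$ flat and $i$ an isomorphism onto the special fibre $(\phi^{-1}(b),x)$; a morphism $\varphi:(T,t)\to(B,b)$ induces the deformation $\varphi^*(i,\phi)$ with total space $\mathscr{X}\times_B T$. The deformation is 1-complete if every deformation of $(X,x)$ over $(\mathbb{C},0)$ (a one-parameter deformation) is isomorphic to $\varphi^*(i,\phi)$ for some $\varphi:(\mathbb{C},0)\to(B,b)$. The deformation of $(H,z)$ induced by $|H|$ is $(H,z)\hookrightarrow(\mathscr{X},(z,H))\to(|H|,H)$ with $\mathscr{X}=\{(x,G)\in\mathbb{P}^n\times|H| : x\in G\}$. Let $S_1,\ldots,S_m$ be analytic types of isolated hypersurface singularities in $n$ variables. A one-parameter deformation $\psi:(\mathscr{Y},y)\to(\mathbb{C},0)$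 is said to include hypersurfaces having $m$ singularities of types $S_1,\ldots,S_m$ if in every neighbourhood of $y$, for parameters $t\neq0$ arbitrarily close to $0$, there are $m$ distinct points $q_1,\ldots,q_m$ of the fibre $\psi^{-1}(t)$ such that the germ of this fibre at $q_k$ is of type $S_k$. Suppose that the deformation of $(H,z)$ induced by $|H|$ is 1-complete, and that some one-parameter deformation of $(H,z)$ includes hypersurfaces having $m$ singularities of types $S_1,\ldots,S_m$. Then there is a morphism $c:(\mathbb{C},0)\to(|H|,H)$ such that the one-parameter deformation of $(H,z)$ induced by $c$, which consists of hypersurfaces $c(t)$ of degree $d$, includes hypersurfaces having $m$ singularities of types $S_1,\ldots,S_m$; that is, for $t\ne 0$ arbitrarily close to $0$ the hypersurface $c(t)\subset\mathbb{P}^n$ has $m$ distinct singular points, arbitrarily close to $z$, of analytic types $S_1,\ldots,S_m$. The same holds if in the hypothesis the $m$ points are required to be the only singular points of the fibre in suitable arbitrarily small neighbourhoods of $y$; then $c$ can be chosen so that the $m$ points are the only singular points of the fibre of the induced deformation in suitable arbitrarily small neighbourhoods of its base point, and the only singular points of $c(t)$ in $\mathbb{P}^n$. -/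

import Mathlib

open Filter Topology

/-! ### Complex space germs

A complex space germ is presented as a closed subgerm of some `ℂ^ι`, cut out at a point `pt` by
finitely many functions that are holomorphic near `pt`. -/

/-- The complex space germ `(V(eqn), pt) ⊆ (ℂ^ι, pt)` with structure sheaf `𝒪 / (eqn)`. -/
structure CGerm (ι : Type) [Fintype ι] where
  pt : ι → ℂ
  κ : Type
  fin : Fintype κ
  eqn : κ → (ι → ℂ) → ℂ
  analytic : ∀ k, AnalyticAt ℂ (eqn k) pt
  vanish : ∀ k, eqn k pt = 0

attribute [instance] CGerm.fin

namespace CGerm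

variable {ι σ τ θ : Type} [Fintype ι] [Fintype σ] [Fintype τ] [Fintype θ]

/-- The germ of `f` at the base point lies in the ideal generated by the equations of `X`. -/
def InIdeal (X : CGerm ι) (f : (ι → ℂ) → ℂ) : Prop :=
  ∃ a : X.κ → (ι → ℂ) → ℂ, (∀ k, AnalyticAt ℂ (a k) X.pt) ∧
    f =ᶠ[𝓝 X.pt] fun x => ∑ k, a k x * X.eqn k x

theorem InIdeal.congr {X : CGerm ι} {f g : (ι → ℂ) → ℂ} (hf : X.InIdeal f)
    (h : g =ᶠ[𝓝 X.pt] f) : X.InIdeal g := by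
  obtain ⟨a, ha, hfa⟩ := hf
  exact ⟨a, ha, h.trans hfa⟩

theorem InIdeal.zero (X : CGerm ι) : X.InIdeal (fun _ => 0) :=
  ⟨fun _ _ => 0, fun _ => analyticAt_const, by simp⟩

theorem InIdeal.add {X : CGerm ι} {f g : (ι → ℂ) → ℂ} (hf : X.InIdeal f) (hg : X.InIdeal g) :
    X.InIdeal (fun x => f x + g x) := by
  obtain ⟨a, ha, hfa⟩ := hf
  obtain ⟨b, hb, hgb⟩ := hg
  refine ⟨fun k x => a k x + b k x, fun k => (ha k).add (hb k), ?_⟩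
  filter_upwards [hfa, hgb] with x h1 h2
  rw [h1, h2, ← Finset.sum_add_distrib]
  exact Finset.sum_congr rfl fun k _ => by ring

theorem InIdeal.mul_left {X : CGerm ι} {c f : (ι → ℂ) → ℂ} (hc : AnalyticAt ℂ c X.pt)
    (hf : X.InIdeal f) : X.InIdeal (fun x => c x * f x) := by
  obtain ⟨a, ha, hfa⟩ := hf
  refine ⟨fun k x => c x * a k x, fun k => hc.mul (ha k), ?_⟩
  filter_upwards [hfa] with x h1
  rw [h1, Finset.mul_sum]
  exact Finset.sum_congr rfl fun k _ => by ring

theorem InIdeal.sum {X : CGerm ι} {κ : Type} (s : Finset κ) {f : κ → (ι → ℂ) → ℂ}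
    (hf : ∀ k ∈ s, X.InIdeal (f k)) : X.InIdeal (fun x => ∑ k ∈ s, f k x) := by
  classical
  induction s using Finset.induction_on with
  | empty => simpa using InIdeal.zero X
  | insert k s hk ih =>
    simp only [Finset.sum_insert hk]
    exact (hf k (by simp)).add (ih fun j hj => hf j (by simp [hj]))

theorem inIdeal_eqn (X : CGerm ι) (k : X.κ) : X.InIdeal (X.eqn k) := by
  classical
  refine ⟨fun j _ => if j = k then 1 else 0, fun _ => analyticAt_const, ?_⟩
  exact .of_eq (by funext x; simp)

/-! ### Local rings -/

/-- The functions on `ℂ^ι` that are holomorphic near `p` (representatives of `𝒪_{ℂ^ι, p}`). -/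
def holo (p : ι → ℂ) : Subring ((ι → ℂ) → ℂ) where
  carrier := {f | AnalyticAt ℂ f p}
  mul_mem' hf hg := hf.mul hg
  one_mem' := analyticAt_const
  add_mem' hf hg := hf.add hg
  zero_mem' := analyticAt_const
  neg_mem' hf := hf.neg

/-- The ideal of `X`; it contains all functions that vanish near the base point, so the quotient
by it is a quotient of the ring of germs. -/
def ideal (X : CGerm ι) : Ideal (holo X.pt) where
  carrier := {f | X.InIdeal f.1}
  add_mem' hf hg := InIdeal.add hf hg
  zero_mem' := InIdeal.zero X
  smul_mem' c _ hf := InIdeal.mul_left c.2 hf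

/-- The analytic local ring `𝒪_{X, pt}` of the germ. -/
abbrev LocalRing (X : CGerm ι) : Type := holo X.pt ⧸ X.ideal

/-! ### Morphisms -/

/-- A representative of a morphism of complex space germs: a holomorphic map germ of the ambient
spaces that pulls the ideal of `Y` back into the ideal of `X`. Two representatives give the same
morphism when their components agree modulo the ideal of `X`, see `CGerm.Same`. -/
structure Hom (X : CGerm ι) (Y : CGerm σ) where
  toFun : (ι → ℂ) → (σ → ℂ)
  analytic : AnalyticAt ℂ toFun X.pt
  map_pt : toFun X.pt = Y.pt
  pull : ∀ k, X.InIdeal (fun x => Y.eqn k (toFun x))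

/-- Two maps into `ℂ^σ` agree on the complex space germ `X`. -/
def Same (X : CGerm ι) (f g : (ι → ℂ) → (σ → ℂ)) : Prop :=
  ∀ j, X.InIdeal (fun x => f x j - g x j)

theorem Hom.pull_inIdeal {X : CGerm ι} {Y : CGerm σ} (φ : Hom X Y) {f : (σ → ℂ) → ℂ}
    (hf : Y.InIdeal f) : X.InIdeal (fun x => f (φ.toFun x)) := by
  obtain ⟨a, ha, hfa⟩ := hf
  have hc : Tendsto φ.toFun (𝓝 X.pt) (𝓝 Y.pt) := by
    have := φ.analytic.continuousAt
    rwa [ContinuousAt, φ.map_pt] at this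
  refine InIdeal.congr (InIdeal.sum Finset.univ (f := fun k x =>
    a k (φ.toFun x) * Y.eqn k (φ.toFun x)) fun k _ => ?_) (hc.eventually hfa)
  refine InIdeal.mul_left ?_ (φ.pull k)
  exact AnalyticAt.fun_comp (by rw [φ.map_pt]; exact ha k) φ.analytic

/-- Composition with a holomorphic map germ. -/
def Hom.compHolo {X : CGerm ι} {Y : CGerm σ} (φ : Hom X Y) : holo Y.pt →+* holo X.pt where
  toFun f := ⟨fun x => f.1 (φ.toFun x),
    AnalyticAt.fun_comp (by rw [φ.map_pt]; exact f.2) φ.analytic⟩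
  map_one' := rfl
  map_mul' _ _ := rfl
  map_zero' := rfl
  map_add' _ _ := rfl

/-- The homomorphism `𝒪_Y → 𝒪_X` of local rings that belongs to a morphism `X → Y`. -/
def Hom.comorphism {X : CGerm ι} {Y : CGerm σ} (φ : Hom X Y) : Y.LocalRing →+* X.LocalRing :=
  Ideal.quotientMap X.ideal φ.compHolo fun _ hf => φ.pull_inIdeal hf

/-- An isomorphism of complex space germs. -/
structure Iso (X : CGerm ι) (Y : CGerm σ) where
  hom : Hom X Y
  inv : Hom Y X
  inv_hom : X.Same (fun x => inv.toFun (hom.toFun x)) id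
  hom_inv : Y.Same (fun y => hom.toFun (inv.toFun y)) id

/-! ### Basic germs -/

/-- The smooth germ `(ℂ^ι, p)`. -/
def affine (p : ι → ℂ) : CGerm ι where
  pt := p
  κ := Empty
  fin := inferInstance
  eqn k := k.elim
  analytic k := k.elim
  vanish k := k.elim

/-- The germ `(ℂ, 0)`. -/
abbrev line : CGerm (Fin 1) := affine 0

/-- The hypersurface germ `(V(f), p)`. -/
def hyper (f : (ι → ℂ) → ℂ) (p : ι → ℂ) (hf : AnalyticAt ℂ f p) (h0 : f p = 0) : CGerm ι where
  pt := p
  κ := Unit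
  fin := inferInstance
  eqn _ := f
  analytic _ := hf
  vanish _ := h0

/-- The germ is that of a complex manifold. -/
def IsRegular (X : CGerm ι) : Prop := ∃ k : ℕ, Nonempty (Iso X (affine (0 : Fin k → ℂ)))

/-- The point `q` lies on the space defined by the equations of `X` (and these are holomorphic
there; this is so for all `q` on `X` near `X.pt`). -/
def Contains (X : CGerm ι) (q : ι → ℂ) : Prop :=
  ∀ k, AnalyticAt ℂ (X.eqn k) q ∧ X.eqn k q = 0

/-- The germ at `q ∈ X` of the fibre through `q` of the map `φ : X → ℂ^σ`. -/
def fibreAt (X : CGerm ι) (φ : (ι → ℂ) → (σ → ℂ)) (q : ι → ℂ) (hX : X.Contains q)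
    (hφ : AnalyticAt ℂ φ q) : CGerm ι where
  pt := q
  κ := X.κ ⊕ σ
  fin := inferInstance
  eqn := Sum.elim X.eqn fun j x => φ x j - φ q j
  analytic := by
    rintro (k | j)
    · exact (hX k).1
    · exact ((analyticAt_pi_iff.1 hφ) j).sub analyticAt_const
  vanish := by
    rintro (k | j)
    · exact (hX k).2
    · simp

theorem contains_pt (X : CGerm ι) : X.Contains X.pt := fun k => ⟨X.analytic k, X.vanish k⟩

theorem analyticAt_left (p : ι ⊕ σ → ℂ) :
    AnalyticAt ℂ (fun (x : ι ⊕ σ → ℂ) (j : ι) => x (Sum.inl j)) p :=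
  analyticAt_pi_iff.2 fun j =>
    (ContinuousLinearMap.proj (R := ℂ) (φ := fun _ : ι ⊕ σ => ℂ) (Sum.inl j)).analyticAt p

theorem analyticAt_right (p : ι ⊕ σ → ℂ) :
    AnalyticAt ℂ (fun (x : ι ⊕ σ → ℂ) (j : σ) => x (Sum.inr j)) p :=
  analyticAt_pi_iff.2 fun j =>
    (ContinuousLinearMap.proj (R := ℂ) (φ := fun _ : ι ⊕ σ => ℂ) (Sum.inr j)).analyticAt p

theorem analyticAt_sumElim {f : (θ → ℂ) → (ι → ℂ)} {g : (θ → ℂ) → (σ → ℂ)} {p : θ → ℂ}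
    (hf : AnalyticAt ℂ f p) (hg : AnalyticAt ℂ g p) :
    AnalyticAt ℂ (fun x => (Sum.elim (f x) (g x) : ι ⊕ σ → ℂ)) p :=
  analyticAt_pi_iff.2 (by
    rintro (j | j)
    · exact (analyticAt_pi_iff.1 hf) j
    · exact (analyticAt_pi_iff.1 hg) j)

/-- The fibre product `X ×_S T`. -/
def fibreProd {X : CGerm τ} {T : CGerm θ} {S : CGerm σ} (φ : Hom X S) (χ : Hom T S) :
    CGerm (τ ⊕ θ) where
  pt := Sum.elim X.pt T.pt
  κ := (X.κ ⊕ T.κ) ⊕ σ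
  fin := inferInstance
  eqn := Sum.elim
    (Sum.elim (fun k x => X.eqn k fun j => x (Sum.inl j)) fun k x => T.eqn k fun j => x (Sum.inr j))
    fun j x => φ.toFun (fun j => x (Sum.inl j)) j - χ.toFun (fun j => x (Sum.inr j)) j
  analytic := by
    rintro ((k | k) | j)
    · exact AnalyticAt.fun_comp (g := X.eqn k) (X.analytic k) (analyticAt_left _)
    · exact AnalyticAt.fun_comp (g := T.eqn k) (T.analytic k) (analyticAt_right _)
    · have h₁ : AnalyticAt ℂ (fun x : τ ⊕ θ → ℂ => φ.toFun fun j => x (Sum.inl j))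
          (Sum.elim X.pt T.pt) :=
        AnalyticAt.fun_comp (g := φ.toFun) φ.analytic (analyticAt_left _)
      have h₂ : AnalyticAt ℂ (fun x : τ ⊕ θ → ℂ => χ.toFun fun j => x (Sum.inr j))
          (Sum.elim X.pt T.pt) :=
        AnalyticAt.fun_comp (g := χ.toFun) χ.analytic (analyticAt_right _)
      exact ((analyticAt_pi_iff.1 h₁) j).sub ((analyticAt_pi_iff.1 h₂) j)
  vanish := by
    rintro ((k | k) | j)
    · exact X.vanish k
    · exact T.vanish k
    · change φ.toFun X.pt j - χ.toFun T.pt j = 0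
      rw [φ.map_pt, χ.map_pt, sub_self]

/-! ### Deformations -/

/-- The data `X → 𝒳 → S` underlying a deformation of `X` over `S`, with `𝒳 ⊆ ℂ^τ`: the composite
is the constant map to the base point of `S`. -/
structure Family (X : CGerm ι) (S : CGerm σ) (τ : Type) [Fintype τ] where
  total : CGerm τ
  incl : Hom X total
  proj : Hom total S
  incl_proj : X.Same (fun x => proj.toFun (incl.toFun x)) fun _ => S.pt

namespace Family

variable {X : CGerm ι} {S : CGerm σ}

/-- The fibre of `𝒳 → S` over the base point. -/
def specialFibre (D : Family X S τ) : CGerm τ :=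
  D.total.fibreAt D.proj.toFun D.total.pt D.total.contains_pt D.proj.analytic

/-- `X → 𝒳 → S` is a deformation of `X`: the projection is flat and the inclusion is an
isomorphism onto the special fibre. -/
def IsDeformation (D : Family X S τ) : Prop :=
  D.proj.comorphism.Flat ∧
    ∃ e : Iso X D.specialFibre, X.Same e.hom.toFun D.incl.toFun

/-- The family induced by a base change `χ : T → S`. -/
def pullback (D : Family X S τ) {T : CGerm θ} (χ : Hom T S) : Family X T (τ ⊕ θ) where
  total := fibreProd D.proj χ
  incl :=
    { toFun := fun x => Sum.elim (D.incl.toFun x) T.pt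
      analytic := analyticAt_sumElim D.incl.analytic analyticAt_const
      map_pt := by
        change Sum.elim (D.incl.toFun X.pt) T.pt = Sum.elim D.total.pt T.pt
        rw [D.incl.map_pt]
      pull := by
        rintro ((k | k) | j)
        · exact D.incl.pull k
        · refine (InIdeal.zero X).congr (.of_eq ?_)
          funext x
          exact T.vanish k
        · refine (D.incl_proj j).congr (.of_eq ?_)
          funext x
          change D.proj.toFun (D.incl.toFun x) j - χ.toFun T.pt j = _
          rw [χ.map_pt] }
  proj :=
    { toFun := fun x j => x (Sum.inr j)
      analytic := analyticAt_right _
      map_pt := rfl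
      pull := fun k => inIdeal_eqn (fibreProd D.proj χ) (Sum.inl (Sum.inr k)) }
  incl_proj := fun j => (InIdeal.zero X).congr (.of_eq (by funext x; simp))

/-- Isomorphism of families of the germ `X` over the same base. -/
def Isomorphic {τ' : Type} [Fintype τ'] (D : Family X S τ) (D' : Family X S τ') : Prop :=
  ∃ e : Iso D.total D'.total,
    X.Same (fun x => e.hom.toFun (D.incl.toFun x)) D'.incl.toFun ∧
    D.total.Same (fun x => D'.proj.toFun (e.hom.toFun x)) D.proj.toFun

/-- Every one-parameter deformation of `X` is isomorphic to one induced from `D`. -/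
def IsOneComplete (D : Family X S τ) : Prop :=
  ∀ (N : ℕ) (E : Family X line (Fin N)), E.IsDeformation →
    ∃ χ : Hom line S, E.Isomorphic (D.pullback χ)

end Family

end CGerm

/-! ### Singularity types -/

/-- A representative `f ∈ ℂ{x₁, …, xₙ}` of an analytic type of isolated hypersurface
singularities. -/
structure IsolatedSing (n : ℕ) where
  f : (Fin n → ℂ) → ℂ
  analytic : AnalyticAt ℂ f 0
  vanish : f 0 = 0
  crit : fderiv ℂ f 0 = 0
  isolated : ∀ᶠ x in 𝓝 (0 : Fin n → ℂ), f x = 0 → fderiv ℂ f x = 0 → x = 0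

/-- The germ `(V(f), 0)`. -/
def IsolatedSing.germ {n : ℕ} (S : IsolatedSing n) : CGerm (Fin n) :=
  CGerm.hyper S.f 0 S.analytic S.vanish

/-- The hypersurface germs `(V(f), p)` and `(V(g), q)` are analytically equivalent: a local
biholomorphism of the ambient spaces carries one to the other. -/
def AnalyticallyEquivalent {n : ℕ} (f : (Fin n → ℂ) → ℂ) (p : Fin n → ℂ)
    (g : (Fin n → ℂ) → ℂ) (q : Fin n → ℂ) : Prop :=
  ∃ Φ Ψ : (Fin n → ℂ) → (Fin n → ℂ),
    AnalyticAt ℂ Φ p ∧ AnalyticAt ℂ Ψ q ∧ Φ p = q ∧ Ψ q = p ∧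
    (∀ᶠ x in 𝓝 p, Ψ (Φ x) = x) ∧ (∀ᶠ y in 𝓝 q, Φ (Ψ y) = y) ∧
    ∃ u : (Fin n → ℂ) → ℂ, AnalyticAt ℂ u p ∧ u p ≠ 0 ∧ ∀ᶠ x in 𝓝 p, f x = u x * g (Φ x)

namespace CGerm.Family

variable {ι τ : Type} [Fintype ι] [Fintype τ] {X : CGerm ι} {n m : ℕ}

/-- The point `q` lies on the total space over `t`, and the germ at `q` of the fibre over `t` is
a singularity of type `S`. -/
def FibreHasType (D : Family X line τ) (t : Fin 1 → ℂ) (q : τ → ℂ) (S : IsolatedSing n) : Prop :=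
  ∃ (hX : D.total.Contains q) (hφ : AnalyticAt ℂ D.proj.toFun q), D.proj.toFun q = t ∧
    Nonempty (Iso (D.total.fibreAt D.proj.toFun q hX hφ) S.germ)

/-- The point `q` is a singular point of the fibre over `t`. -/
def FibreSingular (D : Family X line τ) (t : Fin 1 → ℂ) (q : τ → ℂ) : Prop :=
  ∃ (hX : D.total.Contains q) (hφ : AnalyticAt ℂ D.proj.toFun q), D.proj.toFun q = t ∧
    ¬ (D.total.fibreAt D.proj.toFun q hX hφ).IsRegular

/-- Arbitrarily close to the base point, there are fibres over parameters `t ≠ 0` with `m`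
distinct singular points of the types `S 0, …, S (m - 1)`. -/
def Includes (D : Family X line τ) (S : Fin m → IsolatedSing n) : Prop :=
  ∀ U ∈ 𝓝 D.total.pt, ∃ᶠ t in 𝓝[≠] (0 : Fin 1 → ℂ), ∃ q : Fin m → τ → ℂ,
    Function.Injective q ∧ ∀ k, q k ∈ U ∧ D.FibreHasType t (q k) (S k)

/-- As `Includes`, where the `m` points are the only singular points of the fibre in a suitable
arbitrarily small neighbourhood of the base point. -/
def IncludesOnly (D : Family X line τ) (S : Fin m → IsolatedSing n) : Prop :=
  ∀ U ∈ 𝓝 D.total.pt, ∃ V ∈ 𝓝 D.total.pt, V ⊆ U ∧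
    ∃ᶠ t in 𝓝[≠] (0 : Fin 1 → ℂ), ∃ q : Fin m → τ → ℂ,
      Function.Injective q ∧ (∀ k, q k ∈ V ∧ D.FibreHasType t (q k) (S k)) ∧
      ∀ p ∈ V, D.FibreSingular t p → p ∈ Set.range q

end CGerm.Family

/-! ### Projective hypersurfaces -/

/-- Complex projective space `ℙⁿ`. -/
abbrev PSpace (n : ℕ) : Type := Projectivization ℂ (Fin (n + 1) → ℂ)

/-- The complete linear system of hypersurfaces of degree `d` in `ℙⁿ`: nonzero homogeneous
polynomials of degree `d` up to scalars. -/
abbrev LinSys (n d : ℕ) : Type :=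
  Projectivization ℂ (MvPolynomial.homogeneousSubmodule (Fin (n + 1)) ℂ d)

/-- The exponents of the monomials of degree `d` in `n + 1` variables. -/
abbrev Mon (n d : ℕ) : Type :=
  ↥(Finset.finsuppAntidiag (Finset.univ : Finset (Fin (n + 1))) d)

namespace PSpace

variable {n : ℕ}

/-- Affine coordinates in the chart `{z_i ≠ 0}`. -/
noncomputable def coords (i : Fin (n + 1)) (z : PSpace n) : Fin n → ℂ :=
  fun j => z.rep (i.succAbove j) / z.rep i

/-- The point with given affine coordinates in the chart `{z_i ≠ 0}`. -/
noncomputable def ofCoords (i : Fin (n + 1)) (x : Fin n → ℂ) : PSpace n :=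
  Projectivization.mk ℂ (i.insertNth (α := fun _ => ℂ) 1 x) fun h => by
    have := congrFun h i
    simp at this

end PSpace

namespace LinSys

variable {n d : ℕ}

/-- An equation of the hypersurface, unique up to a nonzero scalar. -/
noncomputable def equation (H : LinSys n d) : MvPolynomial (Fin (n + 1)) ℂ := H.rep.1

/-- The singular points of the hypersurface. -/
def singularPoints (H : LinSys n d) : Set (PSpace n) :=
  {z | MvPolynomial.eval z.rep H.equation = 0 ∧
    ∀ j, MvPolynomial.eval z.rep (MvPolynomial.pderiv j H.equation) = 0}

/-- The equation in the affine chart `{z_i ≠ 0}`. -/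
noncomputable def localEq (H : LinSys n d) (i : Fin (n + 1)) : (Fin n → ℂ) → ℂ :=
  fun x => MvPolynomial.eval (i.insertNth (α := fun _ => ℂ) 1 x) H.equation

/-- The hypersurface has at `z` a singularity of type `S`. -/
def HasSingularityAt (H : LinSys n d) (z : PSpace n) (S : IsolatedSing n) : Prop :=
  ∃ i, z.rep i ≠ 0 ∧ AnalyticallyEquivalent (H.localEq i) (z.coords i) S.f 0

/-- Affine coordinates of the linear system in the chart where the coefficient of the monomial
`μ` is nonzero. -/
noncomputable def coords (μ : Mon n d) (H : LinSys n d) : {ν : Mon n d // ν ≠ μ} → ℂ :=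
  fun ν => H.equation.coeff ν.1.1 / H.equation.coeff μ.1

/-- The polynomial of degree `d` with coefficient `1` at `μ` and the other coefficients `s`. -/
noncomputable def polyOfCoords (μ : Mon n d) (s : {ν : Mon n d // ν ≠ μ} → ℂ) :
    MvPolynomial (Fin (n + 1)) ℂ :=
  MvPolynomial.monomial μ.1 1 + ∑ ν, MvPolynomial.monomial ν.1.1 (s ν)

theorem degree_mon (ν : Mon n d) : Finsupp.degree ν.1 = d := by
  have := (Finset.mem_finsuppAntidiag.1 ν.2).1
  rw [Finsupp.degree_eq_sum]
  exact this

theorem polyOfCoords_mem (μ : Mon n d) (s : {ν : Mon n d // ν ≠ μ} → ℂ) :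
    polyOfCoords μ s ∈ MvPolynomial.homogeneousSubmodule (Fin (n + 1)) ℂ d := by
  refine Submodule.add_mem _ ?_ (Submodule.sum_mem _ fun ν _ => ?_)
  · exact MvPolynomial.isHomogeneous_monomial _ (degree_mon μ)
  · exact MvPolynomial.isHomogeneous_monomial _ (degree_mon ν.1)

theorem coeff_polyOfCoords_self (μ : Mon n d) (s : {ν : Mon n d // ν ≠ μ} → ℂ) :
    (polyOfCoords μ s).coeff μ.1 = 1 := by
  classical
  rw [polyOfCoords, MvPolynomial.coeff_add, MvPolynomial.coeff_monomial, if_pos rfl,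
    MvPolynomial.coeff_sum, Finset.sum_eq_zero, add_zero]
  intro ν _
  rw [MvPolynomial.coeff_monomial, if_neg]
  exact fun h => ν.2 (Subtype.ext h)

/-- The hypersurface with given affine coordinates in the linear system. -/
noncomputable def ofCoords (μ : Mon n d) (s : {ν : Mon n d // ν ≠ μ} → ℂ) : LinSys n d :=
  Projectivization.mk ℂ ⟨polyOfCoords μ s, polyOfCoords_mem μ s⟩ fun h => by
    have h' : polyOfCoords μ s = 0 := congrArg Subtype.val h
    have := coeff_polyOfCoords_self μ s
    rw [h'] at this
    simp at this

theorem equation_eq (H : LinSys n d) (μ : Mon n d) (hμ : H.equation.coeff μ.1 ≠ 0) :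
    H.equation = MvPolynomial.C (H.equation.coeff μ.1) * polyOfCoords μ (H.coords μ) := by
  classical
  have hH : H.equation.IsHomogeneous d := H.rep.2
  have hco : ∀ ν : Mon n d, (polyOfCoords μ (H.coords μ)).coeff ν.1 =
      H.equation.coeff ν.1 / H.equation.coeff μ.1 := by
    intro ν
    by_cases hν : ν = μ
    · rw [hν, coeff_polyOfCoords_self, div_self hμ]
    · rw [polyOfCoords, MvPolynomial.coeff_add, MvPolynomial.coeff_monomial, if_neg
        (fun h => hν (Subtype.ext h.symm)), MvPolynomial.coeff_sum,
        Finset.sum_eq_single ⟨ν, hν⟩, zero_add, MvPolynomial.coeff_monomial, if_pos rfl]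
      · rfl
      · intro ν' _ hne
        rw [MvPolynomial.coeff_monomial, if_neg]
        exact fun h => hne (Subtype.ext (Subtype.ext h))
      · simp
  ext ν
  rw [MvPolynomial.coeff_C_mul]
  by_cases hν : Finsupp.degree ν = d
  · have hm : ν ∈ Finset.finsuppAntidiag (Finset.univ : Finset (Fin (n + 1))) d := by
      rw [Finset.mem_finsuppAntidiag]
      refine ⟨?_, Finset.subset_univ _⟩
      rw [Finsupp.degree_eq_sum] at hν
      exact hν
    rw [hco ⟨ν, hm⟩]
    field_simp
  · rw [hH.coeff_eq_zero hν, MvPolynomial.IsHomogeneous.coeff_eq_zero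
      (polyOfCoords_mem μ (H.coords μ)) hν, mul_zero]

theorem analyticAt_insertNth {θ : Type} [Fintype θ] (i : Fin (n + 1)) {f : (θ → ℂ) → Fin n → ℂ}
    {p : θ → ℂ} (hf : AnalyticAt ℂ f p) (k : Fin (n + 1)) :
    AnalyticAt ℂ (fun x => (i.insertNth (α := fun _ => ℂ) 1 (f x) : Fin (n + 1) → ℂ) k) p := by
  refine Fin.succAboveCases i ?_ (fun j => ?_) k
  · simpa using analyticAt_const
  · simpa using (analyticAt_pi_iff.1 hf) j

theorem analyticAt_eval_monomial {θ : Type} [Fintype θ] (i : Fin (n + 1))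
    {f : (θ → ℂ) → Fin n → ℂ} {c : (θ → ℂ) → ℂ} {p : θ → ℂ} (hf : AnalyticAt ℂ f p)
    (hc : AnalyticAt ℂ c p) (ν : Fin (n + 1) →₀ ℕ) :
    AnalyticAt ℂ (fun x => MvPolynomial.eval (i.insertNth (α := fun _ => ℂ) 1 (f x))
      (MvPolynomial.monomial ν (c x))) p := by
  simp only [MvPolynomial.eval_monomial, Finsupp.prod]
  exact hc.mul (Finset.analyticAt_fun_prod _ fun k _ => (analyticAt_insertNth i hf k).pow _)

theorem analyticAt_eval_polyOfCoords {θ : Type} [Fintype θ] (i : Fin (n + 1)) (μ : Mon n d)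
    {f : (θ → ℂ) → Fin n → ℂ} {s : (θ → ℂ) → {ν : Mon n d // ν ≠ μ} → ℂ} {p : θ → ℂ}
    (hf : AnalyticAt ℂ f p) (hs : AnalyticAt ℂ s p) :
    AnalyticAt ℂ (fun x => MvPolynomial.eval (i.insertNth (α := fun _ => ℂ) 1 (f x))
      (polyOfCoords μ (s x))) p := by
  simp only [polyOfCoords, map_add, map_sum]
  exact (analyticAt_eval_monomial i hf analyticAt_const _).add
    (Finset.analyticAt_fun_sum _ fun ν _ =>
      analyticAt_eval_monomial i hf ((analyticAt_pi_iff.1 hs) ν) _)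

theorem insertNth_coords (i : Fin (n + 1)) (z : PSpace n) (hi : z.rep i ≠ 0) :
    (i.insertNth (α := fun _ => ℂ) 1 (z.coords i) : Fin (n + 1) → ℂ) = (z.rep i)⁻¹ • z.rep := by
  funext k
  refine Fin.succAboveCases i ?_ (fun j => ?_) k
  · simp [hi]
  · simp [PSpace.coords, div_eq_inv_mul]

theorem localEq_coords (H : LinSys n d) {z : PSpace n} {i : Fin (n + 1)} (hi : z.rep i ≠ 0)
    (hz : MvPolynomial.eval z.rep H.equation = 0) : H.localEq i (z.coords i) = 0 := by
  have hH : H.equation.IsHomogeneous d := H.rep.2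
  rw [localEq, insertNth_coords i z hi]
  have key : MvPolynomial.eval ((z.rep i)⁻¹ • z.rep) H.equation =
      (z.rep i)⁻¹ ^ d * MvPolynomial.eval z.rep H.equation := by
    rw [MvPolynomial.eval_eq, MvPolynomial.eval_eq, Finset.mul_sum]
    refine Finset.sum_congr rfl fun ν hν => ?_
    have hdeg : Finsupp.degree ν = d := by
      by_contra hne
      exact (MvPolynomial.mem_support_iff.1 hν) (hH.coeff_eq_zero hne)
    rw [Finsupp.degree_apply] at hdeg
    simp only [Pi.smul_apply, smul_eq_mul, mul_pow, Finset.prod_mul_distrib,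
      Finset.prod_pow_eq_pow_sum]
    rw [hdeg]
    ring
  rw [key, hz, mul_zero]

theorem analyticAt_localEq (H : LinSys n d) (i : Fin (n + 1)) (p : Fin n → ℂ) :
    AnalyticAt ℂ (H.localEq i) p := by
  have h : H.localEq i = fun x => ∑ ν ∈ H.equation.support, MvPolynomial.eval
      (i.insertNth (α := fun _ => ℂ) 1 x) (MvPolynomial.monomial ν (H.equation.coeff ν)) := by
    funext x
    rw [← map_sum, MvPolynomial.support_sum_monomial_coeff]
    rfl
  rw [h]
  exact Finset.analyticAt_fun_sum _ fun ν _ =>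
    analyticAt_eval_monomial i analyticAt_id analyticAt_const ν

theorem localEq_eq (H : LinSys n d) (i : Fin (n + 1)) (μ : Mon n d)
    (hμ : H.equation.coeff μ.1 ≠ 0) (x : Fin n → ℂ) :
    MvPolynomial.eval (i.insertNth (α := fun _ => ℂ) 1 x) (polyOfCoords μ (H.coords μ)) =
      (H.equation.coeff μ.1)⁻¹ * H.localEq i x := by
  have h := congrArg (MvPolynomial.eval (i.insertNth (α := fun _ => ℂ) 1 x)) (H.equation_eq μ hμ)
  rw [map_mul, MvPolynomial.eval_C] at h
  rw [localEq, h, inv_mul_cancel_left₀ hμ]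

/-- The germ `(H, z)` in the affine chart `{z_i ≠ 0}`. -/
noncomputable def germ (H : LinSys n d) (z : PSpace n) (i : Fin (n + 1)) (hi : z.rep i ≠ 0)
    (hz : z ∈ H.singularPoints) : CGerm (Fin n) :=
  CGerm.hyper (H.localEq i) (z.coords i) (H.analyticAt_localEq i _) (H.localEq_coords hi hz.1)

/-- The germ `(|H|, H)` in the affine chart where the coefficient of the monomial `μ` is
nonzero. -/
noncomputable def baseGerm (H : LinSys n d) (μ : Mon n d) : CGerm {ν : Mon n d // ν ≠ μ} :=
  CGerm.affine (H.coords μ)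

/-- The deformation `(H, z) → (𝒳, (z, H)) → (|H|, H)` of `(H, z)` induced by the linear system
`|H|`, where `𝒳 = {(x, G) : x ∈ G} ⊆ ℙⁿ × |H|`, in affine charts of `ℙⁿ` and `|H|`. -/
noncomputable def inducedFamily (H : LinSys n d) (z : PSpace n) (i : Fin (n + 1))
    (hi : z.rep i ≠ 0) (hz : z ∈ H.singularPoints) (μ : Mon n d)
    (hμ : H.equation.coeff μ.1 ≠ 0) :
    CGerm.Family (H.germ z i hi hz) (H.baseGerm μ) (Fin n ⊕ {ν : Mon n d // ν ≠ μ}) where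
  total := CGerm.hyper
    (fun p => MvPolynomial.eval (i.insertNth (α := fun _ => ℂ) 1 fun j => p (Sum.inl j))
      (polyOfCoords μ fun ν => p (Sum.inr ν)))
    (Sum.elim (z.coords i) (H.coords μ))
    (analyticAt_eval_polyOfCoords i μ (CGerm.analyticAt_left _) (CGerm.analyticAt_right _))
    (by
      have h := H.localEq_eq i μ hμ (z.coords i)
      rw [H.localEq_coords hi hz.1, mul_zero] at h
      exact h)
  incl :=
    { toFun := fun x => Sum.elim x (H.coords μ)
      analytic := CGerm.analyticAt_sumElim analyticAt_id analyticAt_const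
      map_pt := rfl
      pull := fun _ => (CGerm.InIdeal.mul_left (c := fun _ => (H.equation.coeff μ.1)⁻¹)
        analyticAt_const (CGerm.inIdeal_eqn (H.germ z i hi hz) ())).congr
        (.of_eq (funext fun x => H.localEq_eq i μ hμ x)) }
  proj :=
    { toFun := fun p ν => p (Sum.inr ν)
      analytic := CGerm.analyticAt_right _
      map_pt := rfl
      pull := fun k => k.elim }
  incl_proj := fun _ => (CGerm.InIdeal.zero _).congr
    (.of_eq (funext fun _ => sub_self (H.coords μ _)))

/-- The hypersurfaces of degree `d` with affine coordinates `c t`, `t ≠ 0`, include ones with `m`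
distinct singular points of the types `S 0, …, S (m - 1)`, for `t` arbitrarily close to `0` and
points arbitrarily close to the point `x₀` of the affine chart `{z_i ≠ 0}`. -/
def CurveIncludes {m : ℕ} (μ : Mon n d) (c : (Fin 1 → ℂ) → {ν : Mon n d // ν ≠ μ} → ℂ)
    (i : Fin (n + 1)) (x₀ : Fin n → ℂ) (S : Fin m → IsolatedSing n) : Prop :=
  ∀ U ∈ 𝓝 x₀, ∃ᶠ t in 𝓝[≠] (0 : Fin 1 → ℂ), ∃ x : Fin m → Fin n → ℂ,
    Function.Injective x ∧
    ∀ k, x k ∈ U ∧ (ofCoords μ (c t)).HasSingularityAt (PSpace.ofCoords i (x k)) (S k)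

/-- As `CurveIncludes`, where the `m` points are the only singular points of the hypersurface
in `ℙⁿ`. -/
def CurveIncludesOnly {m : ℕ} (μ : Mon n d) (c : (Fin 1 → ℂ) → {ν : Mon n d // ν ≠ μ} → ℂ)
    (i : Fin (n + 1)) (x₀ : Fin n → ℂ) (S : Fin m → IsolatedSing n) : Prop :=
  ∀ U ∈ 𝓝 x₀, ∃ᶠ t in 𝓝[≠] (0 : Fin 1 → ℂ), ∃ x : Fin m → Fin n → ℂ,
    Function.Injective x ∧
    (∀ k, x k ∈ U ∧ (ofCoords μ (c t)).HasSingularityAt (PSpace.ofCoords i (x k)) (S k)) ∧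
    (ofCoords μ (c t)).singularPoints = Set.range fun k => PSpace.ofCoords i (x k)

end LinSys

/-! Let `E` be the given one-parameter deformation. 1-completeness yields a curve `c` in `|H|` and
an isomorphism from `E` to the family induced by `c`. What has to be shown is that this isomorphism
carries singular fibres to singular fibres, and that the fibres of the induced family are the
hypersurfaces `c t`, in a sense strong enough to compare analytic types.

An isomorphism of germs is given by finitely many identities modulo ideals. Each is a combination of
equations with holomorphic coefficients, so it persists at all nearby points, and the isomorphism of
families restricts to isomorphisms of the germs of fibres at corresponding points
(`Iso.eventually_fibre`). Working modulo ideals rests on Hadamard's lemma: `f ∘ φ - f ∘ ψ` lies in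
the ideal generated by the `φ_j - ψ_j` (`Same.sub_inIdeal`). Flatness passes along the isomorphism
as well.

In the family induced by `c`, the parameter and the coefficients are constant modulo the ideal of a
fibre, which leaves the germ of the affine equation of `c t` (`fibreIso`). An isomorphism of this
germ with the germ of `S k` is only one of spaces; since the equation of `S k` has zero
differential, the tangent maps are invertible and the isomorphism comes from an ambient
biholomorphism (`Iso.analyticallyEquivalent`).

For the statement on all singular points of `c t` in `ℙⁿ`, compactness forces the singular points of
hypersurfaces near `H` to lie near `z` (`eventually_singularPoints_mem`). They are then singular
points of the fibre near the base point, hence among the `m` given ones. -/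

set_option linter.unusedSectionVars false

/-! ### Hadamard's lemma for analytic functions -/

section Hadamard

variable {𝕜 E F : Type*} [NontriviallyNormedField 𝕜] [NormedAddCommGroup E] [NormedSpace 𝕜 E]
  [NormedAddCommGroup F] [NormedSpace 𝕜 F]

namespace ContinuousMultilinearMap

variable {k : ℕ}

/-- The multilinear map `(u_j, v_j)_j ↦ (w ↦ p (u_0, …, u_{i-1}, w, v_i, …, v_{k-1}))`. -/
noncomputable def dividedDifferenceTerm (p : E [×(k + 1)]→L[𝕜] F) (i : Fin (k + 1)) :
    (E × E) [×k]→L[𝕜] (E →L[𝕜] F) :=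
  (p.curryMid i).flipMultilinear.compContinuousLinearMap fun j =>
    if j.castSucc < i then ContinuousLinearMap.fst 𝕜 E E else ContinuousLinearMap.snd 𝕜 E E

theorem dividedDifferenceTerm_apply (p : E [×(k + 1)]→L[𝕜] F) (i : Fin (k + 1))
    (m : Fin k → E × E) (w : E) :
    p.dividedDifferenceTerm i m w =
      p (i.insertNth (α := fun _ => E) w fun j => if j.castSucc < i then (m j).1 else (m j).2) := by
  change p (i.insertNth (α := fun _ => E) w fun j => _) = _
  congr 2
  funext j
  dsimp only
  split_ifs <;> rfl

theorem norm_dividedDifferenceTerm_le (p : E [×(k + 1)]→L[𝕜] F) (i : Fin (k + 1)) :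
    ‖p.dividedDifferenceTerm i‖ ≤ ‖p‖ := by
  refine opNorm_le_bound (norm_nonneg _) fun m => ?_
  refine ContinuousLinearMap.opNorm_le_bound _ (by positivity) fun w => ?_
  rw [dividedDifferenceTerm_apply]
  refine (p.norm_map_insertNth_le w _).trans ?_
  rw [mul_right_comm]
  gcongr with j
  split_ifs
  · exact norm_fst_le _
  · exact norm_snd_le _

/-- The divided difference of the homogeneous polynomial map of a multilinear map. -/
noncomputable def dividedDifference (p : E [×(k + 1)]→L[𝕜] F) : (E × E) [×k]→L[𝕜] (E →L[𝕜] F) :=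
  ∑ i, p.dividedDifferenceTerm i

/-- The growth is only linear in `k`, so the series of divided differences keeps a positive radius
of convergence. -/
theorem norm_dividedDifference_le (p : E [×(k + 1)]→L[𝕜] F) :
    ‖p.dividedDifference‖ ≤ (k + 1) * ‖p‖ := by
  refine (norm_sum_le Finset.univ p.dividedDifferenceTerm).trans ?_
  refine (Finset.sum_le_sum fun i _ => p.norm_dividedDifferenceTerm_le i).trans ?_
  simp

/-- Telescoping: the arguments `u` are replaced by `v` one slot at a time, and the slot being
changed contributes `u - v`. -/
theorem dividedDifference_apply_sub (p : E [×(k + 1)]→L[𝕜] F) (u v : E) :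
    p.dividedDifference (fun _ => (u, v)) (u - v) = p (fun _ => u) - p (fun _ => v) := by
  -- The zero family would fill the slots outside `Finset.univ`; there are none.
  have h := p.toMultilinearMap.map_piecewise_sub_map_piecewise (fun _ => u) (fun _ => v)
    (fun _ => 0) Finset.univ
  simp only [Finset.piecewise_univ, Finset.mem_univ, if_true] at h
  refine Eq.trans ?_ h.symm
  rw [dividedDifference, sum_apply, _root_.sum_apply]
  refine Finset.sum_congr rfl fun i _ => ?_
  rw [dividedDifferenceTerm_apply]
  change p _ = p _
  congr 1
  funext j
  refine Fin.succAboveCases i ?_ (fun l => ?_) j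
  · simp
  · rw [Fin.insertNth_apply_succAbove]
    rcases lt_or_ge l.castSucc i with hl | hl
    · simp [Fin.succAbove_of_castSucc_lt _ _ hl, hl]
    · have h1 : ¬ l.succ < i := not_lt.2 (hl.trans (Fin.castSucc_lt_succ).le)
      have h2 : l.succ ≠ i := (hl.trans_lt Fin.castSucc_lt_succ).ne'
      simp [Fin.succAbove_of_le_castSucc _ _ hl, hl.not_gt, h1, h2]

end ContinuousMultilinearMap

open scoped ENNReal NNReal in
/-- Hadamard's lemma: the difference `f u - f v` of an analytic function is divisible by `u - v`,
with a quotient that is analytic in `(u, v)`. -/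
theorem AnalyticAt.exists_sub_eq_apply_sub [CompleteSpace F] {f : E → F} {x : E}
    (hf : AnalyticAt 𝕜 f x) :
    ∃ g : E × E → E →L[𝕜] F, AnalyticAt 𝕜 g (x, x) ∧
      ∀ᶠ y in 𝓝 (x, x), f y.1 - f y.2 = g y (y.1 - y.2) := by
  obtain ⟨p, R, hp⟩ := hf
  let q : FormalMultilinearSeries 𝕜 (E × E) (E →L[𝕜] F) := fun k => (p (k + 1)).dividedDifference
  obtain ⟨r, hr0, hrR⟩ : ∃ r : ℝ≥0, 0 < (r : ℝ≥0∞) ∧ (r : ℝ≥0∞) < R :=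
    ENNReal.lt_iff_exists_nnreal_btwn.1 hp.r_pos
  have hr0' : (0 : ℝ) < r := by exact_mod_cast hr0
  obtain ⟨C, hC, hpC⟩ := p.norm_mul_pow_le_of_lt_radius (hrR.trans_le hp.r_le)
  have hq : ((r / 2 : ℝ≥0) : ℝ≥0∞) ≤ q.radius := by
    -- Halving the radius absorbs the factor `k + 1 ≤ 2 ^ k`; the shift of the index from `k + 1` to
    -- `k` costs one factor `r`, whence `C / r`.
    refine q.le_radius_of_bound (C / r) fun k => ?_
    have h1 := (p (k + 1)).norm_dividedDifference_le
    have h2 := hpC (k + 1)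
    have h3 : ((k : ℝ) + 1) ≤ 2 ^ k := by exact_mod_cast Nat.lt_two_pow_self
    rw [le_div_iff₀ hr0']
    calc ‖q k‖ * ((r / 2 : ℝ≥0) : ℝ) ^ k * r
        ≤ ((k + 1) * ‖p (k + 1)‖) * ((r / 2 : ℝ≥0) : ℝ) ^ k * r := by gcongr
      _ = ((k + 1) / 2 ^ k) * (‖p (k + 1)‖ * (r : ℝ) ^ (k + 1)) := by
          push_cast
          rw [div_pow]
          ring
      _ ≤ 1 * C := by
          gcongr
          exact (div_le_one (by positivity)).2 h3
      _ = C := one_mul C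
  have hr2 : (0 : ℝ≥0∞) < ((r / 2 : ℝ≥0) : ℝ≥0∞) := by
    rw [ENNReal.coe_pos]
    exact half_pos (by exact_mod_cast hr0)
  have hq0 : 0 < q.radius := hr2.trans_le hq
  have hqs := q.hasFPowerSeriesOnBall hq0
  refine ⟨fun y => q.sum (y - (x, x)), ?_, ?_⟩
  · have h : AnalyticAt 𝕜 q.sum ((x, x) - (x, x) : E × E) := by
      rw [sub_self]
      exact hqs.analyticAt
    exact AnalyticAt.fun_comp h (analyticAt_id.sub analyticAt_const)
  · have hball : ∀ᶠ y : E × E in 𝓝 (x, x), y ∈ Metric.eball (x, x) (min R q.radius) :=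
      Metric.eball_mem_nhds _ (lt_min hp.r_pos hq0)
    filter_upwards [hball] with y hy
    have hyR : edist y (x, x) < R := lt_of_lt_of_le hy (min_le_left _ _)
    have hyq : edist y (x, x) < q.radius := lt_of_lt_of_le hy (min_le_right _ _)
    rw [Prod.edist_eq, max_lt_iff] at hyR
    have h1 := hp.hasSum_sub (y := y.1) hyR.1
    have h2 := hp.hasSum_sub (y := y.2) hyR.2
    have h3 : HasSum (fun k => q k (fun _ => y - (x, x)) (y.1 - y.2))
        (q.sum (y - (x, x)) (y.1 - y.2)) := by
      refine (ContinuousLinearMap.apply 𝕜 F (y.1 - y.2)).hasSum (q.hasSum ?_)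
      simpa [edist_eq_enorm_sub] using hyq
    -- The constant terms cancel, so the series of `f y.1 - f y.2` starts at order 1, which matches
    -- order 0 of `q`.
    have h4 := (hasSum_nat_add_iff' 1).2 (h1.sub h2)
    have h0 : (p 0 fun _ => y.1 - x) = p 0 fun _ => y.2 - x :=
      congrArg (p 0) (Subsingleton.elim _ _)
    rw [Finset.sum_range_one, h0, sub_self, sub_zero] at h4
    refine h4.unique (h3.congr_fun ?_ )
    intro k
    have := (p (k + 1)).dividedDifference_apply_sub (y.1 - x) (y.2 - x)
    rw [sub_sub_sub_cancel_right] at this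
    exact this.symm

end Hadamard

namespace CGerm

variable {ι σ τ θ : Type} [Fintype ι] [Fintype σ] [Fintype τ] [Fintype θ]

/-! ### Calculus of the ideal of a germ -/

theorem InIdeal.apply_pt {X : CGerm ι} {f : (ι → ℂ) → ℂ} (hf : X.InIdeal f) : f X.pt = 0 := by
  obtain ⟨a, -, hfa⟩ := hf
  rw [hfa.self_of_nhds]
  exact Finset.sum_eq_zero fun k _ => by rw [X.vanish, mul_zero]

theorem InIdeal.neg {X : CGerm ι} {f : (ι → ℂ) → ℂ} (hf : X.InIdeal f) :
    X.InIdeal (fun x => -f x) :=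
  (InIdeal.mul_left (c := fun _ => -1) analyticAt_const hf).congr (.of_eq (by funext x; simp))

theorem Same.refl (X : CGerm ι) (f : (ι → ℂ) → (σ → ℂ)) : X.Same f f :=
  fun _ => (InIdeal.zero X).congr (.of_eq (by funext x; simp))

theorem Same.symm {X : CGerm ι} {f g : (ι → ℂ) → (σ → ℂ)} (h : X.Same f g) : X.Same g f :=
  fun j => (h j).neg.congr (.of_eq (by funext x; simp))

theorem Same.trans {X : CGerm ι} {f g h : (ι → ℂ) → (σ → ℂ)} (h₁ : X.Same f g)
    (h₂ : X.Same g h) : X.Same f h :=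
  fun j => ((h₁ j).add (h₂ j)).congr (.of_eq (by funext x; ring))

theorem Same.apply_pt {X : CGerm ι} {f g : (ι → ℂ) → (σ → ℂ)} (h : X.Same f g) :
    f X.pt = g X.pt :=
  funext fun j => sub_eq_zero.1 (h j).apply_pt

/-- Expanding the Hadamard quotient of `f` in coordinates gives a combination of the `φ_j - ψ_j`
with holomorphic coefficients. Consequently comorphisms and composites do not depend on the
representatives. -/
theorem Same.sub_inIdeal {X : CGerm ι} {φ ψ : (ι → ℂ) → (σ → ℂ)} (h : X.Same φ ψ)
    (hφ : AnalyticAt ℂ φ X.pt) (hψ : AnalyticAt ℂ ψ X.pt) {f : (σ → ℂ) → ℂ}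
    (hf : AnalyticAt ℂ f (φ X.pt)) : X.InIdeal (fun x => f (φ x) - f (ψ x)) := by
  classical
  obtain ⟨g, hg, hfg⟩ := hf.exists_sub_eq_apply_sub
  have hp : AnalyticAt ℂ (fun x => (φ x, ψ x)) X.pt := hφ.prod hψ
  have hpt : (φ X.pt, ψ X.pt) = (φ X.pt, φ X.pt) := by rw [h.apply_pt]
  have hc : Tendsto (fun x => (φ x, ψ x)) (𝓝 X.pt) (𝓝 (φ X.pt, φ X.pt)) := by
    have := hp.continuousAt.tendsto
    rwa [hpt] at this
  have hgp : AnalyticAt ℂ (fun x => g (φ x, ψ x)) X.pt :=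
    AnalyticAt.fun_comp (by rw [hpt]; exact hg) hp
  refine InIdeal.congr (InIdeal.sum Finset.univ (f := fun j x =>
    g (φ x, ψ x) (Pi.single j 1) * (φ x j - ψ x j)) fun j _ => InIdeal.mul_left ?_ (h j)) ?_
  · exact ((ContinuousLinearMap.apply ℂ ℂ (Pi.single j (1 : ℂ) : σ → ℂ)).analyticAt _).comp hgp
  · filter_upwards [hc.eventually hfg] with x hx
    rw [hx]
    have hsum := pi_eq_sum_univ' (φ x - ψ x)
    conv_lhs => rw [hsum]
    rw [map_sum]
    refine Finset.sum_congr rfl fun j _ => ?_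
    rw [map_smul, smul_eq_mul, mul_comm]
    rfl

theorem Same.comp_left {X : CGerm ι} {φ ψ : (ι → ℂ) → (σ → ℂ)} (h : X.Same φ ψ)
    (hφ : AnalyticAt ℂ φ X.pt) (hψ : AnalyticAt ℂ ψ X.pt) {f : (σ → ℂ) → (τ → ℂ)}
    (hf : AnalyticAt ℂ f (φ X.pt)) : X.Same (fun x => f (φ x)) (fun x => f (ψ x)) :=
  fun j => h.sub_inIdeal hφ hψ (f := fun y => f y j) ((analyticAt_pi_iff.1 hf) j)

theorem Same.comp_right {X : CGerm ι} {Y : CGerm σ} {f g : (σ → ℂ) → (τ → ℂ)} (h : Y.Same f g)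
    (φ : Hom X Y) : X.Same (fun x => f (φ.toFun x)) (fun x => g (φ.toFun x)) :=
  fun j => φ.pull_inIdeal (h j)

/-! ### Composition and the category of germs -/

/-- Composition of morphisms of germs. -/
def Hom.comp {X : CGerm ι} {Y : CGerm σ} {Z : CGerm τ} (ψ : Hom Y Z) (φ : Hom X Y) : Hom X Z where
  toFun x := ψ.toFun (φ.toFun x)
  analytic := AnalyticAt.fun_comp (by rw [φ.map_pt]; exact ψ.analytic) φ.analytic
  map_pt := by rw [φ.map_pt, ψ.map_pt]
  pull k := φ.pull_inIdeal (ψ.pull k)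

theorem Hom.analytic_at_image {X : CGerm ι} {Y : CGerm σ} {Z : CGerm τ} (ψ : Hom Y Z)
    (φ : Hom X Y) : AnalyticAt ℂ ψ.toFun (φ.toFun X.pt) := by
  rw [φ.map_pt]
  exact ψ.analytic

/-- The inverse isomorphism. -/
def Iso.symm {X : CGerm ι} {Y : CGerm σ} (e : Iso X Y) : Iso Y X where
  hom := e.inv
  inv := e.hom
  inv_hom := e.hom_inv
  hom_inv := e.inv_hom

/-- Serves both halves of `Iso.trans`: the inner cancellation is pulled back along `φ` and then
pushed through `φ'` by Hadamard's lemma. -/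
theorem Hom.same_comp_of_same_id {X : CGerm ι} {Y : CGerm σ} {Z : CGerm τ} (φ : Hom X Y)
    (φ' : Hom Y X) (ψ : Hom Y Z) (ψ' : Hom Z Y)
    (h₁ : X.Same (fun x => φ'.toFun (φ.toFun x)) id)
    (h₂ : Y.Same (fun y => ψ'.toFun (ψ.toFun y)) id) :
    X.Same (fun x => (φ'.comp ψ').toFun ((ψ.comp φ).toFun x)) id := by
  have h : X.Same (fun x => ψ'.toFun (ψ.toFun (φ.toFun x))) φ.toFun := h₂.comp_right φ
  exact (h.comp_left (ψ'.comp (ψ.comp φ)).analytic φ.analytic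
    (φ'.analytic_at_image (ψ'.comp (ψ.comp φ)))).trans h₁

/-- Composition of isomorphisms. -/
def Iso.trans {X : CGerm ι} {Y : CGerm σ} {Z : CGerm τ} (e : Iso X Y) (e' : Iso Y Z) :
    Iso X Z where
  hom := e'.hom.comp e.hom
  inv := e.inv.comp e'.inv
  inv_hom := Hom.same_comp_of_same_id e.hom e.inv e'.hom e'.inv e.inv_hom e'.inv_hom
  hom_inv := Hom.same_comp_of_same_id e'.inv e'.hom e.inv e.hom e'.hom_inv e.hom_inv

theorem IsRegular.of_iso {X : CGerm ι} {Y : CGerm σ} (e : Iso X Y) (h : Y.IsRegular) :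
    X.IsRegular := by
  obtain ⟨k, ⟨eY⟩⟩ := h
  exact ⟨k, ⟨e.trans eY⟩⟩

/-- The relation between the projections of two families is symmetric. -/
theorem Iso.same_symm {X : CGerm ι} {Y : CGerm σ} (e : Iso X Y) {φ : (ι → ℂ) → (τ → ℂ)}
    {ψ : (σ → ℂ) → (τ → ℂ)} (hψ : AnalyticAt ℂ ψ Y.pt)
    (h : X.Same (fun x => ψ (e.hom.toFun x)) φ) : Y.Same (fun y => φ (e.inv.toFun y)) ψ := by
  refine (h.comp_right e.inv).symm.trans ?_
  exact e.hom_inv.comp_left (e.hom.comp e.inv).analytic analyticAt_id (f := ψ)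
    (by rw [e.inv.map_pt, e.hom.map_pt]; exact hψ)

/-! ### Flatness and isomorphisms -/

theorem Hom.comorphism_eq_of_same {X : CGerm ι} {Y : CGerm σ} {φ ψ : Hom X Y}
    (h : X.Same φ.toFun ψ.toFun) : φ.comorphism = ψ.comorphism := by
  refine Ideal.Quotient.ringHom_ext (RingHom.ext fun f => ?_)
  refine Ideal.Quotient.eq.2 ?_
  exact h.sub_inIdeal φ.analytic ψ.analytic (f := f.1) (by rw [φ.map_pt]; exact f.2)

theorem Hom.comorphism_comp {X : CGerm ι} {Y : CGerm σ} {Z : CGerm τ} (ψ : Hom Y Z)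
    (φ : Hom X Y) : (ψ.comp φ).comorphism = φ.comorphism.comp ψ.comorphism :=
  Ideal.Quotient.ringHom_ext (RingHom.ext fun _ => rfl)

/-- The identity morphism. -/
def Hom.id (X : CGerm ι) : Hom X X where
  toFun := _root_.id
  analytic := analyticAt_id
  map_pt := rfl
  pull := X.inIdeal_eqn

theorem Hom.comorphism_id (X : CGerm ι) : (Hom.id X).comorphism = RingHom.id _ :=
  Ideal.Quotient.ringHom_ext (RingHom.ext fun _ => rfl)

theorem Iso.comorphism_bijective {X : CGerm ι} {Y : CGerm σ} (e : Iso X Y) :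
    Function.Bijective e.hom.comorphism := by
  have h₁ : (e.hom.comorphism).comp e.inv.comorphism = RingHom.id _ := by
    rw [← Hom.comorphism_comp, ← Hom.comorphism_id]
    exact Hom.comorphism_eq_of_same e.inv_hom
  have h₂ : (e.inv.comorphism).comp e.hom.comorphism = RingHom.id _ := by
    rw [← Hom.comorphism_comp, ← Hom.comorphism_id]
    exact Hom.comorphism_eq_of_same e.hom_inv
  exact Function.bijective_iff_has_inverse.2
    ⟨e.inv.comorphism, fun a => RingHom.congr_fun h₂ a, fun a => RingHom.congr_fun h₁ a⟩

/-- The two comorphisms differ by the bijective comorphism of `e`, which does not affect flatness.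
In this way the induced family inherits flatness from the given deformation, with no study of the
incidence variety. -/
theorem Family.Isomorphic.flat {X : CGerm ι} {S : CGerm σ} {D : Family X S τ}
    {D' : Family X S θ} (h : D.Isomorphic D') (hD : D.proj.comorphism.Flat) :
    D'.proj.comorphism.Flat := by
  obtain ⟨e, -, he⟩ := h
  have hcomp : e.hom.comorphism.comp D'.proj.comorphism = D.proj.comorphism := by
    rw [← Hom.comorphism_comp]
    exact Hom.comorphism_eq_of_same he
  rwa [← hcomp, RingHom.Flat.comp_iff_of_bijective_left e.comorphism_bijective] at hD

/-! ### Germs at nearby points -/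

/-- The germ at `q` of the space defined by the equations of `X`. -/
def localize (X : CGerm ι) (q : ι → ℂ) (hq : X.Contains q) : CGerm ι where
  pt := q
  κ := X.κ
  fin := X.fin
  eqn := X.eqn
  analytic k := (hq k).1
  vanish k := (hq k).2

/-- The coefficients are holomorphic and the identity holds on a whole neighbourhood, so one
combination serves at every nearby point. -/
theorem InIdeal.eventually_localize {X : CGerm ι} {f : (ι → ℂ) → ℂ} (hf : X.InIdeal f) :
    ∀ᶠ q in 𝓝 X.pt, ∀ hq : X.Contains q, (X.localize q hq).InIdeal f := by
  obtain ⟨a, ha, hfa⟩ := hf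
  filter_upwards [hfa.eventually_nhds, eventually_all.2 fun k => (ha k).eventually_analyticAt]
    with q h1 h2 hq
  exact ⟨a, h2, h1⟩

theorem Same.eventually_localize {X : CGerm ι} {f g : (ι → ℂ) → (σ → ℂ)} (h : X.Same f g) :
    ∀ᶠ q in 𝓝 X.pt, ∀ hq : X.Contains q, (X.localize q hq).Same f g := by
  filter_upwards [eventually_all.2 fun j => (h j).eventually_localize] with q h1 hq j
  exact h1 j hq

theorem Hom.tendsto {X : CGerm ι} {Y : CGerm σ} (φ : Hom X Y) :
    Tendsto φ.toFun (𝓝 X.pt) (𝓝 Y.pt) := by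
  have := φ.analytic.continuousAt
  rwa [ContinuousAt, φ.map_pt] at this

theorem Hom.eventually_pull {X : CGerm ι} {Y : CGerm σ} (φ : Hom X Y) :
    ∀ᶠ q in 𝓝 X.pt, ∀ hq : X.Contains q,
      (∀ k, (X.localize q hq).InIdeal fun x => Y.eqn k (φ.toFun x)) ∧
        Y.Contains (φ.toFun q) := by
  filter_upwards [eventually_all.2 fun k => (φ.pull k).eventually_localize,
    φ.tendsto.eventually (eventually_all.2 fun k => (Y.analytic k).eventually_analyticAt)]
    with q h1 h2 hq
  exact ⟨fun k => h1 k hq, fun k => ⟨h2 k, (h1 k hq).apply_pt⟩⟩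

/-- Passing to the fibre only adds generators, which receive the coefficient 0. -/
theorem InIdeal.fibreAt {X : CGerm ι} {f : (ι → ℂ) → ℂ} {φ : (ι → ℂ) → (σ → ℂ)} {q : ι → ℂ}
    {hX : X.Contains q} (hφ : AnalyticAt ℂ φ q) (hf : (X.localize q hX).InIdeal f) :
    (X.fibreAt φ q hX hφ).InIdeal f := by
  obtain ⟨a, ha, hfa⟩ := hf
  refine ⟨Sum.elim a fun _ _ => 0, ?_, ?_⟩
  · rintro (k | j)
    · exact ha k
    · exact analyticAt_const
  · refine hfa.trans (.of_eq ?_)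
    funext x
    refine Eq.trans ?_ (Fintype.sum_sum_type (α₁ := X.κ) (α₂ := σ) _).symm
    refine (add_zero _).symm.trans (congrArg₂ _ rfl ?_)
    exact (Finset.sum_eq_zero fun j _ => zero_mul _).symm

/-- A morphism that is compatible with maps to `ℂ^τ` restricts to the fibres. -/
def Hom.onFibre {X : CGerm ι} {Y : CGerm σ} {f : (ι → ℂ) → (σ → ℂ)}
    {φ : (ι → ℂ) → (τ → ℂ)} {ψ : (σ → ℂ) → (τ → ℂ)} {q : ι → ℂ} {y : σ → ℂ}
    (hX : X.Contains q) (hφ : AnalyticAt ℂ φ q) (hY : Y.Contains y) (hψ : AnalyticAt ℂ ψ y)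
    (hf : AnalyticAt ℂ f q) (hfq : f q = y)
    (hpull : ∀ k, (X.localize q hX).InIdeal fun x => Y.eqn k (f x))
    (hs : (X.localize q hX).Same (fun x => ψ (f x)) φ) :
    Hom (X.fibreAt φ q hX hφ) (Y.fibreAt ψ y hY hψ) where
  toFun := f
  analytic := hf
  map_pt := hfq
  pull := by
    rintro (k | j)
    · exact (hpull k).fibreAt hφ
    · have hval : ψ (f q) = φ q := hs.apply_pt
      -- Split `ψ ∘ f - ψ y` as `(ψ ∘ f - φ) + (φ - φ q)`: the first part lies in the ideal by
      -- compatibility, the second is an equation of the fibre.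
      refine (((hs j).fibreAt hφ).add
        ((X.fibreAt φ q hX hφ).inIdeal_eqn (Sum.inr j))).congr (.of_eq ?_)
      funext x
      change ψ (f x) j - ψ y j = ψ (f x) j - φ x j + (φ x j - φ q j)
      rw [← hfq, hval]
      ring

/-- An isomorphism compatible with maps to `ℂ^τ` induces, at all points near the base point,
isomorphisms of the fibres. -/
theorem Iso.eventually_fibre {X : CGerm ι} {Y : CGerm σ} (e : Iso X Y)
    {φ : (ι → ℂ) → (τ → ℂ)} {ψ : (σ → ℂ) → (τ → ℂ)} (hφ : AnalyticAt ℂ φ X.pt)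
    (hψ : AnalyticAt ℂ ψ Y.pt) (h : X.Same (fun x => ψ (e.hom.toFun x)) φ) :
    ∀ᶠ q in 𝓝 X.pt, ∀ hX : X.Contains q,
      e.inv.toFun (e.hom.toFun q) = q ∧ ψ (e.hom.toFun q) = φ q ∧
      ∃ (hφq : AnalyticAt ℂ φ q) (hY : Y.Contains (e.hom.toFun q))
        (hψq : AnalyticAt ℂ ψ (e.hom.toFun q)),
        Nonempty (Iso (X.fibreAt φ q hX hφq) (Y.fibreAt ψ (e.hom.toFun q) hY hψq)) := by
  have h' := e.same_symm hψ h
  -- All conditions that make `e` an isomorphism compatible with `φ` and `ψ` spread to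
  -- neighbourhoods; those on the side of `Y` are brought back to `X` by continuity of `e.hom`.
  filter_upwards [hφ.eventually_analyticAt, e.hom.tendsto.eventually hψ.eventually_analyticAt,
    e.hom.analytic.eventually_analyticAt, e.hom.tendsto.eventually
      e.inv.analytic.eventually_analyticAt, e.hom.eventually_pull,
    e.hom.tendsto.eventually e.inv.eventually_pull, h.eventually_localize,
    e.hom.tendsto.eventually h'.eventually_localize, e.inv_hom.eventually_localize,
    e.hom.tendsto.eventually e.hom_inv.eventually_localize]
    with q hφq hψq hhom hinv hpull hpull' hs hs' hid hid' hX
  obtain ⟨hpull, hY⟩ := hpull hX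
  have hq : e.inv.toFun (e.hom.toFun q) = q := (hid hX).apply_pt
  refine ⟨hq, (hs hX).apply_pt, hφq, hY, hψq, ⟨?_⟩⟩
  exact
    { hom := Hom.onFibre hX hφq hY hψq hhom rfl hpull (hs hX)
      inv := Hom.onFibre hY hψq hX hφq hinv hq (hpull' hY).1 (hs' hY)
      inv_hom := fun j => (hid hX j).fibreAt hφq
      hom_inv := fun j => (hid' hY j).fibreAt hψq }

end CGerm

/-! ### Transport of singular fibres along isomorphisms of families -/

namespace CGerm.Family

variable {ι τ θ : Type} [Fintype ι] [Fintype τ] [Fintype θ] {X : CGerm ι} {n m : ℕ}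
  {D : Family X line τ} {D' : Family X line θ}

theorem FibreHasType.of_iso {t : Fin 1 → ℂ} {q : τ → ℂ} {q' : θ → ℂ} {S : IsolatedSing n}
    (h : D.FibreHasType t q S) (hqq' : D'.proj.toFun q' = D.proj.toFun q)
    (hiso : ∀ hX : D.total.Contains q, ∃ (hφ : AnalyticAt ℂ D.proj.toFun q)
      (hX' : D'.total.Contains q') (hφ' : AnalyticAt ℂ D'.proj.toFun q'),
      Nonempty (Iso (D.total.fibreAt D.proj.toFun q hX hφ)
        (D'.total.fibreAt D'.proj.toFun q' hX' hφ'))) : D'.FibreHasType t q' S := by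
  obtain ⟨hX, hφ, ht, ⟨e⟩⟩ := h
  obtain ⟨_, hX', hφ', ⟨e'⟩⟩ := hiso hX
  exact ⟨hX', hφ', hqq'.trans ht, ⟨e'.symm.trans e⟩⟩

theorem FibreSingular.of_iso {t : Fin 1 → ℂ} {q : τ → ℂ} {q' : θ → ℂ}
    (h : D.FibreSingular t q) (hqq' : D'.proj.toFun q' = D.proj.toFun q)
    (hiso : ∀ hX : D.total.Contains q, ∃ (hφ : AnalyticAt ℂ D.proj.toFun q)
      (hX' : D'.total.Contains q') (hφ' : AnalyticAt ℂ D'.proj.toFun q'),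
      Nonempty (Iso (D.total.fibreAt D.proj.toFun q hX hφ)
        (D'.total.fibreAt D'.proj.toFun q' hX' hφ'))) : D'.FibreSingular t q' := by
  obtain ⟨hX, hφ, ht, hsing⟩ := h
  obtain ⟨_, hX', hφ', ⟨e'⟩⟩ := hiso hX
  exact ⟨hX', hφ', hqq'.trans ht, fun hreg => hsing (hreg.of_iso e')⟩

theorem FibreHasType.contains {t : Fin 1 → ℂ} {q : τ → ℂ} {S : IsolatedSing n}
    (h : D.FibreHasType t q S) : D.total.Contains q := h.1

/-- The points are moved by `e.hom`. They stay distinct because `e.inv` undoes `e.hom` at points of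
the space, although not on the ambient `ℂ^τ`. -/
theorem Includes.of_isomorphic {S : Fin m → IsolatedSing n} (h : D.Includes S)
    (hiso : D.Isomorphic D') : D'.Includes S := by
  obtain ⟨e, -, he⟩ := hiso
  intro U hU
  have hgood := e.eventually_fibre D.proj.analytic D'.proj.analytic he
  refine (h _ (inter_mem hgood (e.hom.tendsto hU))).mono ?_
  rintro t ⟨q, hinj, hq⟩
  refine ⟨fun k => e.hom.toFun (q k), fun k l hkl => hinj ?_, fun k => ⟨(hq k).1.2, ?_⟩⟩
  · rw [← ((hq k).1.1 (hq k).2.contains).1, ← ((hq l).1.1 (hq l).2.contains).1]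
    exact congrArg e.inv.toFun hkl
  · have hg := (hq k).1.1
    exact (hq k).2.of_iso (hg (hq k).2.contains).2.1 fun hX => (hg hX).2.2

/-- Here the neighbourhoods must match in both directions. The new one is the preimage of `V` under
`e.inv`, cut down to where `e.inv` respects fibres: a singular point in it goes back into `V`, hence
to some `q k`. -/
theorem IncludesOnly.of_isomorphic {S : Fin m → IsolatedSing n} (h : D.IncludesOnly S)
    (hiso : D.Isomorphic D') : D'.IncludesOnly S := by
  obtain ⟨e, -, he⟩ := hiso
  intro U hU
  have hgood := e.eventually_fibre D.proj.analytic D'.proj.analytic he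
  have hgood' := e.symm.eventually_fibre D'.proj.analytic D.proj.analytic
    (e.same_symm D'.proj.analytic he)
  have hW := inter_mem hgood' hU
  obtain ⟨V, hV, hVU, hfreq⟩ := h _ (inter_mem hgood (e.hom.tendsto hW))
  refine ⟨_, inter_mem hW (e.inv.tendsto hV), fun y hy => hy.1.2, hfreq.mono ?_⟩
  rintro t ⟨q, hinj, hq, honly⟩
  have hqinv : ∀ k, e.inv.toFun (e.hom.toFun (q k)) = q k := fun k =>
    ((hVU (hq k).1).1 (hq k).2.contains).1
  refine ⟨fun k => e.hom.toFun (q k), fun k l hkl => hinj ?_, fun k => ⟨⟨?_, ?_⟩, ?_⟩, ?_⟩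
  · rw [← hqinv k, ← hqinv l]
    exact congrArg e.inv.toFun hkl
  · exact (hVU (hq k).1).2
  · change e.inv.toFun (e.hom.toFun (q k)) ∈ V
    rw [hqinv k]
    exact (hq k).1
  · have hg := (hVU (hq k).1).1
    exact (hq k).2.of_iso (hg (hq k).2.contains).2.1 fun hX => (hg hX).2.2
  · rintro y ⟨⟨hy, -⟩, hyV⟩ hsing
    have hy' := hy hsing.1
    obtain ⟨k, hk⟩ := honly _ hyV (hsing.of_iso hy'.2.1 fun hX => (hy hX).2.2)
    exact ⟨k, (congrArg e.hom.toFun hk).trans hy'.1⟩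

end CGerm.Family

/-! ### Local biholomorphisms -/

/-- On the slice `(u, x)` one has `f u = g (u, x) (u - x) + f x`; in the product rule at `u = x` the
term with the derivative of `g` is killed by `u - x = 0`. -/
theorem HasFDerivAt.eq_apply_of_sub_eq {𝕜 E F : Type*} [NontriviallyNormedField 𝕜]
    [NormedAddCommGroup E] [NormedSpace 𝕜 E] [NormedAddCommGroup F] [NormedSpace 𝕜 F]
    {f : E → F} {f' : E →L[𝕜] F} {x : E} {g : E × E → E →L[𝕜] F}
    (hg : AnalyticAt 𝕜 g (x, x))
    (h : ∀ᶠ y in 𝓝 (x, x), f y.1 - f y.2 = g y (y.1 - y.2)) (hf : HasFDerivAt f f' x) :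
    g (x, x) = f' := by
  have hp : HasFDerivAt (fun u : E => (u, x)) (ContinuousLinearMap.inl 𝕜 E E) x :=
    hasFDerivAt_prodMk_left x x
  have h1 := HasFDerivAt.comp x (f := fun u : E => (u, x)) hg.differentiableAt.hasFDerivAt hp
  have h2 := (h1.clm_apply ((hasFDerivAt_id x).sub_const x)).add_const (f x)
  have h3 : f =ᶠ[𝓝 x] fun u => g (u, x) (u - x) + f x := by
    filter_upwards [hp.continuousAt.eventually h] with u hu
    exact sub_eq_iff_eq_add.1 hu
  have h4 := (h2.congr_of_eventuallyEq h3).unique hf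
  rw [← h4]
  ext w
  simp

theorem AnalyticAt.exists_analytic_inverse {E F : Type*} [NormedAddCommGroup E] [NormedSpace ℂ E]
    [CompleteSpace E] [NormedAddCommGroup F] [NormedSpace ℂ F] [CompleteSpace F] {φ : E → F}
    {p : E} (hφ : AnalyticAt ℂ φ p) (i : E ≃L[ℂ] F) (hi : fderiv ℂ φ p = i) :
    ∃ ψ : F → E, AnalyticAt ℂ ψ (φ p) ∧ ψ (φ p) = p ∧
      (∀ᶠ x in 𝓝 p, ψ (φ x) = x) ∧ ∀ᶠ y in 𝓝 (φ p), φ (ψ y) = y := by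
  have hs : HasStrictFDerivAt φ (i : E →L[ℂ] F) p := hi ▸ hφ.hasStrictFDerivAt
  let h := hs.toOpenPartialHomeomorph φ
  have hp : p ∈ h.source := hs.mem_toOpenPartialHomeomorph_source
  exact ⟨h.symm, h.analyticAt_symm' hp hφ hi, h.left_inv hp, h.eventually_left_inverse hp,
    h.eventually_right_inverse (h.map_source hp)⟩

namespace CGerm

variable {ι σ : Type} [Fintype ι] [Fintype σ]

/-! ### Tangent maps of isomorphisms -/

/-- Product rule: each equation vanishes at the base point together with its differential. -/
theorem InIdeal.hasFDerivAt {X : CGerm ι} (hX : ∀ k, fderiv ℂ (X.eqn k) X.pt = 0)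
    {f : (ι → ℂ) → ℂ} (hf : X.InIdeal f) : HasFDerivAt f (0 : (ι → ℂ) →L[ℂ] ℂ) X.pt := by
  obtain ⟨a, ha, hfa⟩ := hf
  refine HasFDerivAt.congr_of_eventuallyEq ?_ hfa
  have h : HasFDerivAt (fun x => ∑ k, a k x * X.eqn k x)
      (∑ k : X.κ, (0 : (ι → ℂ) →L[ℂ] ℂ)) X.pt := by
    refine HasFDerivAt.fun_sum fun k _ => ?_
    have h := (ha k).differentiableAt.hasFDerivAt.mul
      (X.analytic k).differentiableAt.hasFDerivAt
    refine h.congr_fderiv (ContinuousLinearMap.ext fun w => ?_)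
    simp [hX, X.vanish]
  simpa using h

/-- The composite differs from the identity by elements of the ideal, whose differentials vanish at
the base point. -/
theorem Iso.fderiv_comp {X : CGerm ι} {Y : CGerm σ} (e : Iso X Y)
    (hX : ∀ k, fderiv ℂ (X.eqn k) X.pt = 0) :
    (fderiv ℂ e.inv.toFun Y.pt).comp (fderiv ℂ e.hom.toFun X.pt) =
      ContinuousLinearMap.id ℂ (ι → ℂ) := by
  have h1 : HasFDerivAt (fun x => e.inv.toFun (e.hom.toFun x) - x)
      (0 : (ι → ℂ) →L[ℂ] (ι → ℂ)) X.pt :=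
    hasFDerivAt_pi'.2 fun j => by
      rw [ContinuousLinearMap.comp_zero]
      exact (e.inv_hom j).hasFDerivAt hX
  have h2 := h1.add (hasFDerivAt_id X.pt)
  have h3 : HasFDerivAt e.inv.toFun (fderiv ℂ e.inv.toFun Y.pt) (e.hom.toFun X.pt) := by
    rw [e.hom.map_pt]
    exact e.inv.analytic.differentiableAt.hasFDerivAt
  have h4 := h3.comp X.pt e.hom.analytic.differentiableAt.hasFDerivAt
  rw [zero_add] at h2
  refine h4.unique (h2.congr_of_eventuallyEq (.of_eq ?_))
  funext x
  simp

/-- A hypersurface germ with vanishing differential that is regular has the equation `0`. -/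
theorem eventually_eq_zero_of_isRegular {f : (ι → ℂ) → ℂ} {p : ι → ℂ} (hf : AnalyticAt ℂ f p)
    (h0 : f p = 0) (hd : fderiv ℂ f p = 0) (h : (hyper f p hf h0).IsRegular) :
    ∀ᶠ x in 𝓝 p, f x = 0 := by
  obtain ⟨k, ⟨e⟩⟩ := h
  have h1 := e.fderiv_comp fun _ => hd
  -- The smooth germ has no equations, so the other composite of tangent maps is the identity too.
  have h2 := e.symm.fderiv_comp fun k => k.elim
  let i : (Fin k → ℂ) ≃L[ℂ] (ι → ℂ) := ContinuousLinearEquiv.equivOfInverse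
    (fderiv ℂ e.inv.toFun 0) (fderiv ℂ e.hom.toFun p)
    (fun v => DFunLike.congr_fun h2 v) (fun v => DFunLike.congr_fun h1 v)
  have hs : HasStrictFDerivAt e.inv.toFun (i : (Fin k → ℂ) →L[ℂ] (ι → ℂ)) 0 :=
    e.inv.analytic.hasStrictFDerivAt
  -- The ideal of the smooth germ is zero, so `f ∘ e.inv` vanishes near 0; by the inverse function
  -- theorem `e.inv` covers a neighbourhood of `p`.
  obtain ⟨a, -, ha⟩ := e.inv.pull ()
  have hmap := hs.map_nhds_eq_of_equiv
  have hpt : e.inv.toFun 0 = p := e.inv.map_pt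
  rw [hpt] at hmap
  rw [← hmap, eventually_map]
  exact ha.mono fun y hy => hy.trans (Finset.sum_eq_zero fun k _ => k.elim)

/-- Isomorphic hypersurface germs in the same dimension, one of which is singular, are
analytically equivalent. -/
theorem Iso.analyticallyEquivalent {n : ℕ} {f g : (Fin n → ℂ) → ℂ} {p q : Fin n → ℂ}
    {hf : AnalyticAt ℂ f p} {hfp : f p = 0} {hg : AnalyticAt ℂ g q} {hgq : g q = 0}
    (e : Iso (hyper f p hf hfp) (hyper g q hg hgq)) (hd : fderiv ℂ g q = 0) :
    AnalyticallyEquivalent f p g q := by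
  set φ := e.hom.toFun
  set ψ := e.inv.toFun
  have hφ : AnalyticAt ℂ φ p := e.hom.analytic
  have hψ : AnalyticAt ℂ ψ q := e.inv.analytic
  have hφp : φ p = q := e.hom.map_pt
  have hψq : ψ q = p := e.inv.map_pt
  have hD : (fderiv ℂ φ p).comp (fderiv ℂ ψ q) = ContinuousLinearMap.id ℂ _ :=
    e.symm.fderiv_comp fun _ => hd
  -- Only `g` is known to have zero differential, which gives a one-sided inverse; equality of
  -- dimensions makes it two-sided.
  have hD' : (fderiv ℂ ψ q).comp (fderiv ℂ φ p) = ContinuousLinearMap.id ℂ _ := by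
    have h := (LinearMap.comp_eq_id_comm (f := (fderiv ℂ φ p : (Fin n → ℂ) →ₗ[ℂ] (Fin n → ℂ)))
      (g := (fderiv ℂ ψ q : (Fin n → ℂ) →ₗ[ℂ] (Fin n → ℂ)))).1
      (LinearMap.ext fun v => DFunLike.congr_fun hD v)
    exact ContinuousLinearMap.ext fun v => DFunLike.congr_fun h v
  let i : (Fin n → ℂ) ≃L[ℂ] (Fin n → ℂ) := ContinuousLinearEquiv.equivOfInverse
    (fderiv ℂ φ p) (fderiv ℂ ψ q)
    (fun v => DFunLike.congr_fun hD' v) (fun v => DFunLike.congr_fun hD v)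
  obtain ⟨Ψ, hΨ, hΨp, hΨφ, hφΨ⟩ := hφ.exists_analytic_inverse i rfl
  rw [hφp] at hΨ hΨp hφΨ
  refine ⟨φ, Ψ, hφ, hΨ, hφp, hΨp, hΨφ, hφΨ, ?_⟩
  obtain ⟨u, hu, hgφ⟩ := e.hom.pull ()
  obtain ⟨v, hv, hfψ⟩ := e.inv.pull ()
  replace hgφ : ∀ᶠ x in 𝓝 p, g (φ x) = u () x * f x :=
    hgφ.mono fun x hx => hx.trans (Fintype.sum_unique (ι := Unit) _)
  replace hfψ : ∀ᶠ y in 𝓝 q, f (ψ y) = v () y * g y :=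
    hfψ.mono fun x hx => hx.trans (Fintype.sum_unique (ι := Unit) _)
  -- If `u p ≠ 0`, then `u⁻¹` is the required unit. Otherwise both equations turn out to vanish
  -- identically near their points, and the unit 1 will do.
  by_cases hup : u () p = 0
  · choose a ha hid using e.hom_inv
    replace hid : ∀ᶠ y in 𝓝 q, ∀ j, φ (ψ y) j - y j = a j () y * g y :=
      eventually_all.2 fun j => (hid j).mono fun x hx =>
        hx.trans (Fintype.sum_unique (ι := Unit) _)
    obtain ⟨G, hG, hgG⟩ := hg.exists_sub_eq_apply_sub
    have hGq : G (q, q) = 0 := by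
      rw [HasFDerivAt.eq_apply_of_sub_eq hG hgG hg.differentiableAt.hasFDerivAt, hd]
    have hψc : Tendsto ψ (𝓝 q) (𝓝 p) := hψq ▸ hψ.continuousAt.tendsto
    have hφc : Tendsto φ (𝓝 p) (𝓝 q) := hφp ▸ hφ.continuousAt.tendsto
    have hpair : Tendsto (fun y => (φ (ψ y), y)) (𝓝 q) (𝓝 (q, q)) :=
      (hφc.comp hψc).prodMk_nhds tendsto_id
    have hac : Tendsto (fun y j => a j () y) (𝓝 q) (𝓝 fun j => a j () q) :=
      tendsto_pi_nhds.2 fun j => (ha j ()).continuousAt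
    have hGa : Tendsto (fun w : ((Fin n → ℂ) × (Fin n → ℂ)) × (Fin n → ℂ) => G w.1 w.2)
        (𝓝 ((q, q), fun j => a j () q)) (𝓝 (G (q, q) fun j => a j () q)) :=
      ContinuousAt.clm_apply (ContinuousAt.comp (g := G) (f := Prod.fst)
        (x := ((q, q), fun j => a j () q)) hG.continuousAt continuousAt_fst) continuousAt_snd
    -- Since `φ (ψ y) - y = g y • a y`, Hadamard's lemma gives `g (φ (ψ y)) = g y * (1 + G a)`,
    -- while the pullback relations give `u (ψ y) * v y * g y`. So `g` times this factor is zero,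
    -- and the factor tends to 1 because `G (q, q)` is the differential of `g` at `q` and `u p = 0`.
    have hlim : Tendsto (fun y => 1 + G (φ (ψ y), y) (fun j => a j () y) - u () (ψ y) * v () y)
        (𝓝 q) (𝓝 (1 + G (q, q) (fun j => a j () q) - u () p * v () q)) :=
      (tendsto_const_nhds.add (hGa.comp (hpair.prodMk_nhds hac))).sub
        (((hu ()).continuousAt.tendsto.comp hψc).mul (hv ()).continuousAt.tendsto)
    rw [hGq, hup] at hlim
    have hne := hlim.eventually_ne (b₂ := 0) (by simp)
    have hg0 : ∀ᶠ y in 𝓝 q, g y = 0 := by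
      filter_upwards [hne, hid, hpair.eventually hgG, hψc.eventually hgφ, hfψ]
        with y h1 h2 h3 h4 h5
      have h6 : φ (ψ y) - y = g y • fun j => a j () y := by
        funext j
        rw [Pi.sub_apply, h2 j, Pi.smul_apply, smul_eq_mul, mul_comm]
      change g (φ (ψ y)) - g y = G _ (φ (ψ y) - y) at h3
      rw [h6, map_smul, smul_eq_mul, h4, h5] at h3
      refine (mul_eq_zero.1 ?_).resolve_right h1
      linear_combination -h3
    have hs : HasStrictFDerivAt ψ (i.symm : (Fin n → ℂ) →L[ℂ] (Fin n → ℂ)) q :=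
      hψ.hasStrictFDerivAt
    have hmap := hs.map_nhds_eq_of_equiv
    rw [hψq] at hmap
    have hf0 : ∀ᶠ x in 𝓝 p, f x = 0 := by
      rw [← hmap, eventually_map]
      filter_upwards [hfψ, hg0] with y h1 h2
      rw [h1, h2, mul_zero]
    refine ⟨fun _ => 1, analyticAt_const, one_ne_zero, ?_⟩
    filter_upwards [hf0, hφc.eventually hg0] with x h1 h2
    rw [h1, h2, mul_zero]
  · refine ⟨fun x => (u () x)⁻¹, (hu ()).inv hup, inv_ne_zero hup, ?_⟩
    filter_upwards [hgφ, (hu ()).continuousAt.eventually_ne hup] with x h1 h2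
    rw [h1, inv_mul_cancel_left₀ h2]

end CGerm

theorem AnalyticallyEquivalent.singular {n : ℕ} {f g : (Fin n → ℂ) → ℂ} {p q : Fin n → ℂ}
    (h : AnalyticallyEquivalent f p g q) (hg : AnalyticAt ℂ g q) (hgq : g q = 0)
    (hd : fderiv ℂ g q = 0) : f p = 0 ∧ fderiv ℂ f p = 0 := by
  obtain ⟨φ, -, hφ, -, hφp, -, -, -, u, hu, -, hfu⟩ := h
  refine ⟨by rw [hfu.self_of_nhds, hφp, hgq, mul_zero], ?_⟩
  have h1 : HasFDerivAt g (fderiv ℂ g q) (φ p) := by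
    rw [hφp]
    exact hg.differentiableAt.hasFDerivAt
  have h2 := hu.differentiableAt.hasFDerivAt.mul
    (h1.comp p hφ.differentiableAt.hasFDerivAt)
  refine ((h2.congr_fderiv (ContinuousLinearMap.ext fun w => ?_)).congr_of_eventuallyEq hfu).fderiv
  simp [hd, hφp, hgq]

/-! ### Singular zeros of polynomials -/

namespace MvPolynomial

theorem hasFDerivAt_eval {σ : Type*} [Fintype σ] (P : MvPolynomial σ ℂ) (y : σ → ℂ) :
    HasFDerivAt (fun v => eval v P)
      (∑ j, eval y (pderiv j P) • ContinuousLinearMap.proj (R := ℂ) (φ := fun _ : σ => ℂ) j) y := by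
  classical
  induction P using MvPolynomial.induction_on with
  | C a =>
    simp only [eval_C]
    refine (hasFDerivAt_const (𝕜 := ℂ) a y).congr_fderiv (ContinuousLinearMap.ext fun w => ?_)
    simp
  | add P Q hP hQ =>
    simp only [map_add]
    refine (hP.add hQ).congr_fderiv (ContinuousLinearMap.ext fun w => ?_)
    simp [add_mul, Finset.sum_add_distrib]
  | mul_X P k hP =>
    simp only [map_mul, eval_X]
    refine (hP.mul (ContinuousLinearMap.proj (R := ℂ) (φ := fun _ : σ => ℂ) k).hasFDerivAt
      ).congr_fderiv (ContinuousLinearMap.ext fun w => ?_)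
    simp only [Derivation.leibniz, pderiv_X, map_add, smul_eq_mul, map_mul, eval_X,
      add_apply, smul_apply, ContinuousLinearMap.proj_apply,
      sum_apply, add_mul, Finset.sum_add_distrib, Finset.mul_sum]
    congr 1
    · rw [Finset.sum_eq_single k]
      · simp
      · intro j _ hj
        simp [Pi.single_eq_of_ne hj.symm]
      · simp
    · exact Finset.sum_congr rfl fun j _ => by ring

theorem IsHomogeneous.eval_smul {σ R : Type*} [CommRing R] {P : MvPolynomial σ R} {d : ℕ}
    (hP : P.IsHomogeneous d) (a : R) (v : σ → R) : eval (a • v) P = a ^ d * eval v P := by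
  rw [eval_eq, eval_eq, Finset.mul_sum]
  refine Finset.sum_congr rfl fun ν hν => ?_
  have hdeg : Finsupp.degree ν = d := by
    by_contra hne
    exact (mem_support_iff.1 hν) (hP.coeff_eq_zero hne)
  rw [Finsupp.degree_apply] at hdeg
  simp only [Pi.smul_apply, smul_eq_mul, mul_pow, Finset.prod_mul_distrib,
    Finset.prod_pow_eq_pow_sum]
  rw [hdeg]
  ring

/-- The polynomial and all its partial derivatives vanish at `v`. -/
def SingularAt {σ : Type*} (P : MvPolynomial σ ℂ) (v : σ → ℂ) : Prop :=
  eval v P = 0 ∧ ∀ j, eval v (pderiv j P) = 0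

theorem SingularAt.smul {σ : Type*} {P : MvPolynomial σ ℂ} {d : ℕ} (hP : P.IsHomogeneous d)
    {v : σ → ℂ} (h : P.SingularAt v) (a : ℂ) : P.SingularAt (a • v) :=
  ⟨by rw [hP.eval_smul, h.1, mul_zero], fun j => by rw [hP.pderiv.eval_smul, h.2 j, mul_zero]⟩

theorem singularAt_smul_iff {σ : Type*} {P : MvPolynomial σ ℂ} {d : ℕ} (hP : P.IsHomogeneous d)
    {v : σ → ℂ} {a : ℂ} (ha : a ≠ 0) : P.SingularAt (a • v) ↔ P.SingularAt v :=
  ⟨fun h => by simpa [smul_smul, ha] using h.smul hP a⁻¹, fun h => h.smul hP a⟩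

theorem singularAt_C_mul_iff {σ : Type*} {P : MvPolynomial σ ℂ} {v : σ → ℂ} {a : ℂ} (ha : a ≠ 0) :
    (C a * P).SingularAt v ↔ P.SingularAt v := by
  simp [SingularAt, ha]

/-- The Jacobian criterion in an affine chart. -/
theorem singularAt_insertNth_iff {n d : ℕ} {P : MvPolynomial (Fin (n + 1)) ℂ}
    (hP : P.IsHomogeneous d) (i : Fin (n + 1)) (x : Fin n → ℂ) :
    P.SingularAt (i.insertNth (α := fun _ => ℂ) 1 x) ↔
      eval (i.insertNth (α := fun _ => ℂ) 1 x) P = 0 ∧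
        fderiv ℂ (fun x => eval (i.insertNth (α := fun _ => ℂ) 1 x) P) x = 0 := by
  have hins : HasFDerivAt (fun x : Fin n → ℂ => (i.insertNth (α := fun _ => ℂ) 1 x :
      Fin (n + 1) → ℂ)) (ContinuousLinearMap.pi (Fin.insertNth i 0 fun j =>
        ContinuousLinearMap.proj (R := ℂ) (φ := fun _ : Fin n => ℂ) j)) x := by
    refine hasFDerivAt_pi'.2 fun k => ?_
    refine Fin.succAboveCases i ?_ (fun j => ?_) k
    · simpa using hasFDerivAt_const (1 : ℂ) x
    · simp only [Fin.insertNth_apply_succAbove]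
      refine (hasFDerivAt_apply (𝕜 := ℂ) j x).congr_fderiv (ContinuousLinearMap.ext fun w => ?_)
      simp
  have hfd := ((hasFDerivAt_eval P (i.insertNth (α := fun _ => ℂ) 1 x)).comp x hins).fderiv
  have hfd' : ∀ w, fderiv ℂ (fun x => eval (i.insertNth (α := fun _ => ℂ) 1 x) P) x w =
      ∑ j, eval (i.insertNth (α := fun _ => ℂ) 1 x) (pderiv (i.succAbove j) P) * w j := by
    intro w
    refine (DFunLike.congr_fun hfd w).trans ?_
    simp [Fin.sum_univ_succAbove _ i]
  refine and_congr_right fun h0 => ⟨fun h => ?_, fun h => ?_⟩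
  · ext w
    simp [hfd', h]
  · have hj : ∀ j, eval (i.insertNth (α := fun _ => ℂ) 1 x) (pderiv (i.succAbove j) P) = 0 := by
      intro j
      have := hfd' (Pi.single j 1)
      rw [h] at this
      simpa [Pi.single_apply] using this.symm
    -- Euler's relation recovers the partial derivative in direction `i`, which the chart does not
    -- see, since the `i`-th coordinate is 1.
    have he := congrArg (eval (i.insertNth (α := fun _ => ℂ) 1 x)) hP.sum_X_mul_pderiv
    rw [map_sum, Fin.sum_univ_succAbove _ i] at he
    simp only [map_mul, eval_X, Fin.insertNth_apply_same, one_mul, hj, mul_zero,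
      Finset.sum_const_zero, add_zero, map_nsmul, h0, smul_zero] at he
    exact fun k => Fin.succAboveCases i he hj k

end MvPolynomial

/-! ### Charts of projective space and of the linear system -/

namespace PSpace

variable {n : ℕ}

theorem exists_rep_ofCoords (i : Fin (n + 1)) (x : Fin n → ℂ) :
    ∃ a : ℂ, a ≠ 0 ∧ (ofCoords i x).rep = a • i.insertNth (α := fun _ => ℂ) 1 x := by
  obtain ⟨a, ha⟩ := Projectivization.exists_smul_eq_mk_rep ℂ
    (i.insertNth (α := fun _ => ℂ) 1 x : Fin (n + 1) → ℂ) (fun h => by simpa using congrFun h i)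
  exact ⟨a, a.ne_zero, ha.symm⟩

theorem rep_ofCoords_ne_zero (i : Fin (n + 1)) (x : Fin n → ℂ) : (ofCoords i x).rep i ≠ 0 := by
  obtain ⟨a, ha, h⟩ := exists_rep_ofCoords i x
  simpa [h] using ha

theorem coords_ofCoords (i : Fin (n + 1)) (x : Fin n → ℂ) : (ofCoords i x).coords i = x := by
  obtain ⟨a, ha, h⟩ := exists_rep_ofCoords i x
  funext j
  simp [coords, h, ha]

theorem ofCoords_coords {i : Fin (n + 1)} {z : PSpace n} (hi : z.rep i ≠ 0) :
    ofCoords i (z.coords i) = z := by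
  conv_rhs => rw [← z.mk_rep]
  refine (Projectivization.mk_eq_mk_iff' ℂ _ _ _ _).2 ⟨(z.rep i)⁻¹, ?_⟩
  exact (LinSys.insertNth_coords i z hi).symm

end PSpace

namespace LinSys

variable {n d : ℕ}

theorem isHomogeneous_equation (H : LinSys n d) : H.equation.IsHomogeneous d := H.rep.2

theorem equation_ne_zero (H : LinSys n d) : H.equation ≠ 0 :=
  fun h => H.rep_nonzero (Subtype.ext h)

theorem exists_equation_ofCoords (μ : Mon n d) (s : {ν : Mon n d // ν ≠ μ} → ℂ) :
    ∃ a : ℂ, a ≠ 0 ∧ (ofCoords μ s).equation = MvPolynomial.C a * polyOfCoords μ s := by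
  obtain ⟨a, ha⟩ := Projectivization.exists_smul_eq_mk_rep ℂ
    (⟨polyOfCoords μ s, polyOfCoords_mem μ s⟩ : MvPolynomial.homogeneousSubmodule _ ℂ d)
    (fun h => by
      have h' : polyOfCoords μ s = 0 := congrArg Subtype.val h
      simpa [h'] using coeff_polyOfCoords_self μ s)
  refine ⟨a, a.ne_zero, ?_⟩
  rw [← MvPolynomial.smul_eq_C_mul]
  exact (congrArg Subtype.val ha).symm

theorem singularAt_equation_ofCoords (μ : Mon n d) (s : {ν : Mon n d // ν ≠ μ} → ℂ)
    (v : Fin (n + 1) → ℂ) :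
    (ofCoords μ s).equation.SingularAt v ↔ (polyOfCoords μ s).SingularAt v := by
  obtain ⟨a, ha, h⟩ := exists_equation_ofCoords μ s
  rw [h, MvPolynomial.singularAt_C_mul_iff ha]

theorem mem_singularPoints_iff (H : LinSys n d) {z : PSpace n} {i : Fin (n + 1)}
    (hi : z.rep i ≠ 0) :
    z ∈ H.singularPoints ↔
      H.localEq i (z.coords i) = 0 ∧ fderiv ℂ (H.localEq i) (z.coords i) = 0 := by
  have h := MvPolynomial.singularAt_insertNth_iff H.isHomogeneous_equation i (z.coords i)
  rw [insertNth_coords i z hi, MvPolynomial.singularAt_smul_iff H.isHomogeneous_equation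
    (inv_ne_zero hi), ← insertNth_coords i z hi] at h
  exact h

/-- The affine equation of a hypersurface does not vanish identically near any point. -/
theorem not_eventually_localEq_eq_zero (H : LinSys n d) (i : Fin (n + 1)) (p : Fin n → ℂ) :
    ¬ ∀ᶠ x in 𝓝 p, H.localEq i x = 0 := by
  intro h
  have h0 : H.localEq i = 0 := AnalyticOnNhd.eq_of_eventuallyEq (z₀ := p)
    (fun x _ => H.analyticAt_localEq i x) (fun x _ => analyticAt_const) h
  -- The factor `X i` takes care of the hyperplane `v i = 0` outside the chart.
  have h1 : MvPolynomial.X i * H.equation = 0 := by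
    refine MvPolynomial.funext fun v => ?_
    rw [map_mul, MvPolynomial.eval_X, map_zero]
    by_cases hv : v i = 0
    · rw [hv, zero_mul]
    · have h2 : v = v i • (i.insertNth (α := fun _ => ℂ) 1 fun j => v (i.succAbove j) / v i :
          Fin (n + 1) → ℂ) := by
        funext k
        refine Fin.succAboveCases i ?_ (fun j => ?_) k
        · simp
        · simp [mul_div_cancel₀ _ hv]
      have h3 := congrFun h0 fun j => v (i.succAbove j) / v i
      rw [h2, H.isHomogeneous_equation.eval_smul]
      change _ * (_ * H.localEq i _) = 0
      rw [h3]
      simp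
  exact H.equation_ne_zero ((mul_eq_zero.1 h1).resolve_left (MvPolynomial.X_ne_zero i))

theorem continuous_eval_polyOfCoords (μ : Mon n d) :
    Continuous fun q : ({ν : Mon n d // ν ≠ μ} → ℂ) × (Fin (n + 1) → ℂ) =>
      MvPolynomial.eval q.2 (polyOfCoords μ q.1) := by
  simp only [polyOfCoords, map_add, map_sum, MvPolynomial.eval_monomial, Finsupp.prod]
  fun_prop

theorem continuous_eval_pderiv_polyOfCoords (μ : Mon n d) (j : Fin (n + 1)) :
    Continuous fun q : ({ν : Mon n d // ν ≠ μ} → ℂ) × (Fin (n + 1) → ℂ) =>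
      MvPolynomial.eval q.2 (MvPolynomial.pderiv j (polyOfCoords μ q.1)) := by
  simp only [polyOfCoords, map_add, map_sum, MvPolynomial.pderiv_monomial,
    MvPolynomial.eval_monomial, Finsupp.prod]
  fun_prop

theorem eventually_not_singularAt (μ : Mon n d) {s : {ν : Mon n d // ν ≠ μ} → ℂ}
    {v : Fin (n + 1) → ℂ} (h : ¬ (polyOfCoords μ s).SingularAt v) :
    ∀ᶠ q : ({ν : Mon n d // ν ≠ μ} → ℂ) × (Fin (n + 1) → ℂ) in 𝓝 (s, v),
      ¬ (polyOfCoords μ q.1).SingularAt q.2 := by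
  rw [MvPolynomial.SingularAt, not_and_or, not_forall] at h
  rcases h with h | ⟨j, h⟩
  · filter_upwards [(continuous_eval_polyOfCoords μ).continuousAt.eventually_ne h] with q hq hs
    exact hq hs.1
  · filter_upwards [(continuous_eval_pderiv_polyOfCoords μ j).continuousAt.eventually_ne h]
      with q hq hs
    exact hq (hs.2 j)

/-- The singular points of hypersurfaces close to `H` are close to the only singular point of
`H`. -/
theorem eventually_singularPoints_mem (H : LinSys n d) (z : PSpace n)
    (huniq : ∀ w ∈ H.singularPoints, w = z) (i : Fin (n + 1)) (hi : z.rep i ≠ 0)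
    (μ : Mon n d) (hμ : H.equation.coeff μ.1 ≠ 0) {W : Set (Fin n → ℂ)}
    (hW : W ∈ 𝓝 (z.coords i)) :
    ∀ᶠ s in 𝓝 (H.coords μ), ∀ w ∈ (ofCoords μ s).singularPoints,
      w.rep i ≠ 0 ∧ w.coords i ∈ W := by
  -- Compactness of the unit sphere reduces this to a condition near each `(H.coords μ, v)`. If `v`
  -- is singular for `H`, it represents `z` and its chart coordinates vary continuously; if not,
  -- non-singularity is open in both variables.
  have key : ∀ᶠ s in 𝓝 (H.coords μ), ∀ v ∈ Metric.sphere (0 : Fin (n + 1) → ℂ) 1,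
      (polyOfCoords μ s).SingularAt v → v i ≠ 0 ∧ (fun j => v (i.succAbove j) / v i) ∈ W := by
    refine (isCompact_sphere _ _).eventually_forall_of_forall_eventually fun v hv => ?_
    by_cases hs : (polyOfCoords μ (H.coords μ)).SingularAt v
    · have hv0 : v ≠ 0 := ne_zero_of_mem_unit_sphere ⟨v, hv⟩
      have hsing : H.equation.SingularAt v := by
        rw [H.equation_eq μ hμ]
        exact (MvPolynomial.singularAt_C_mul_iff hμ).2 hs
      obtain ⟨a, ha⟩ := Projectivization.exists_smul_eq_mk_rep ℂ v hv0
      have hz : Projectivization.mk ℂ v hv0 = z := by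
        refine huniq _ ?_
        change H.equation.SingularAt (Projectivization.mk ℂ v hv0).rep
        rw [← ha]
        exact hsing.smul H.isHomogeneous_equation a
      rw [hz] at ha
      have hvi : v i ≠ 0 := by
        intro h0
        apply hi
        rw [← ha, Pi.smul_apply, h0, smul_zero]
      have hvz : (fun j => v (i.succAbove j) / v i) = z.coords i := by
        funext j
        rw [PSpace.coords, ← ha]
        change _ = (a : ℂ) * _ / ((a : ℂ) * _)
        rw [mul_div_mul_left _ _ a.ne_zero]
      have hc : ContinuousAt (fun v : Fin (n + 1) → ℂ => fun j => v (i.succAbove j) / v i) v :=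
        continuousAt_pi.2 fun j => (continuous_apply _).continuousAt.div
          (continuous_apply _).continuousAt hvi
      have h1 : ∀ᶠ v' in 𝓝 v, v' i ≠ 0 ∧ (fun j => v' (i.succAbove j) / v' i) ∈ W :=
        ((continuous_apply i).continuousAt.eventually_ne hvi).and
          (hc.eventually_mem (by rw [hvz]; exact hW))
      filter_upwards [continuousAt_snd.eventually h1] with q hq _
      exact hq
    · filter_upwards [eventually_not_singularAt μ hs] with q hq hq'
      exact absurd hq' hq
  filter_upwards [key] with s hs w hw
  have hw0 : ‖w.rep‖ ≠ 0 := norm_ne_zero_iff.2 w.rep_nonzero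
  have hw0' : (‖w.rep‖ : ℂ)⁻¹ ≠ 0 := inv_ne_zero (by exact_mod_cast hw0)
  have hsing : (polyOfCoords μ s).SingularAt w.rep :=
    (singularAt_equation_ofCoords μ s _).1 hw
  -- Normalising the representative to the unit sphere changes neither singularity nor affine
  -- coordinates.
  have h := hs ((‖w.rep‖ : ℂ)⁻¹ • w.rep)
    (by simp [norm_smul, hw0]) (hsing.smul (polyOfCoords_mem μ s) _)
  simp only [Pi.smul_apply, smul_eq_mul, mul_div_mul_left _ _ hw0'] at h
  exact ⟨right_ne_zero_of_mul h.1, h.2⟩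

end LinSys

namespace LinSys

variable {n d m : ℕ}

theorem exists_localEq_ofCoords (i : Fin (n + 1)) (μ : Mon n d)
    (s : {ν : Mon n d // ν ≠ μ} → ℂ) :
    ∃ a : ℂ, a ≠ 0 ∧ ∀ x, (ofCoords μ s).localEq i x =
      a * MvPolynomial.eval (i.insertNth (α := fun _ => ℂ) 1 x) (polyOfCoords μ s) := by
  obtain ⟨a, ha, h⟩ := exists_equation_ofCoords μ s
  exact ⟨a, ha, fun x => by rw [localEq, h, map_mul, MvPolynomial.eval_C]⟩

/-! ### Fibres of the families induced by curves in the linear system -/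

section Fibres

variable {H : LinSys n d} {z : PSpace n} {i : Fin (n + 1)} {hi : z.rep i ≠ 0}
  {hz : z ∈ H.singularPoints} {μ : Mon n d} {hμ : H.equation.coeff μ.1 ≠ 0}
  {c : CGerm.Hom CGerm.line (H.baseGerm μ)}

/-- The point `x` of the hypersurface `c t`, as a point of the ambient space of the induced
family. -/
def curvePoint (c : CGerm.Hom CGerm.line (H.baseGerm μ)) (x : Fin n → ℂ) (t : Fin 1 → ℂ) :
    (Fin n ⊕ {ν : Mon n d // ν ≠ μ}) ⊕ Fin 1 → ℂ :=
  Sum.elim (Sum.elim x (c.toFun t)) t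

/-- `Contains` includes analyticity at `q` of the graph equations `s_ν - c_ν(t)`; freezing `s_ν`
isolates `c_ν`. -/
theorem analyticAt_curve_of_contains {q : (Fin n ⊕ {ν : Mon n d // ν ≠ μ}) ⊕ Fin 1 → ℂ}
    (hq : ((H.inducedFamily z i hi hz μ hμ).pullback c).total.Contains q) :
    AnalyticAt ℂ c.toFun (fun j => q (Sum.inr j)) := by
  refine analyticAt_pi_iff.2 fun ν => ?_
  have h1 := (hq (Sum.inr ν)).1
  have h2 : AnalyticAt ℂ (fun t : Fin 1 → ℂ =>
      (Sum.elim (fun j => q (Sum.inl j)) t : (Fin n ⊕ {ν : Mon n d // ν ≠ μ}) ⊕ Fin 1 → ℂ))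
      (fun j => q (Sum.inr j)) :=
    CGerm.analyticAt_sumElim analyticAt_const analyticAt_id
  have hqq : (Sum.elim (fun j => q (Sum.inl j)) fun j => q (Sum.inr j)) = q := by
    funext k
    rcases k with k | k <;> rfl
  have h3 := AnalyticAt.fun_comp (by rw [hqq]; exact h1) h2
  refine (analyticAt_const (v := q (Sum.inl (Sum.inr ν)))).sub h3 |>.congr (.of_eq ?_)
  funext t
  exact sub_sub_cancel _ _

theorem eq_curvePoint_of_contains {q : (Fin n ⊕ {ν : Mon n d // ν ≠ μ}) ⊕ Fin 1 → ℂ}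
    (hq : ((H.inducedFamily z i hi hz μ hμ).pullback c).total.Contains q) :
    q = curvePoint c (fun j => q (Sum.inl (Sum.inl j))) fun j => q (Sum.inr j) := by
  funext k
  rcases k with (k | ν) | k
  · rfl
  · exact sub_eq_zero.1 (hq (Sum.inr ν)).2
  · rfl

theorem eval_eq_zero_of_contains {q : (Fin n ⊕ {ν : Mon n d // ν ≠ μ}) ⊕ Fin 1 → ℂ}
    (hq : ((H.inducedFamily z i hi hz μ hμ).pullback c).total.Contains q) :
    MvPolynomial.eval (i.insertNth (α := fun _ => ℂ) 1 fun j => q (Sum.inl (Sum.inl j)))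
      (polyOfCoords μ (c.toFun fun j => q (Sum.inr j))) = 0 := by
  have h := (hq (Sum.inl (Sum.inl ()))).2
  have h' : (fun ν => q (Sum.inl (Sum.inr ν))) = c.toFun fun j => q (Sum.inr j) :=
    funext fun ν => sub_eq_zero.1 (hq (Sum.inr ν)).2
  rw [← h']
  exact h

theorem contains_curvePoint {x : Fin n → ℂ} {t : Fin 1 → ℂ} (hc : AnalyticAt ℂ c.toFun t)
    (h0 : MvPolynomial.eval (i.insertNth (α := fun _ => ℂ) 1 x)
      (polyOfCoords μ (c.toFun t)) = 0) :
    ((H.inducedFamily z i hi hz μ hμ).pullback c).total.Contains (curvePoint c x t) := by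
  rintro ((k | k) | ν)
  · refine ⟨?_, h0⟩
    exact analyticAt_eval_polyOfCoords i μ
      (analyticAt_pi_iff.2 fun j => (ContinuousLinearMap.proj (R := ℂ)
        (φ := fun _ : (Fin n ⊕ {ν : Mon n d // ν ≠ μ}) ⊕ Fin 1 => ℂ)
          (Sum.inl (Sum.inl j))).analyticAt _)
      (analyticAt_pi_iff.2 fun j => (ContinuousLinearMap.proj (R := ℂ)
        (φ := fun _ : (Fin n ⊕ {ν : Mon n d // ν ≠ μ}) ⊕ Fin 1 => ℂ)
          (Sum.inl (Sum.inr j))).analyticAt _)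
  · exact k.elim
  · refine ⟨?_, sub_self _⟩
    have h1 : AnalyticAt ℂ (fun y : (Fin n ⊕ {ν : Mon n d // ν ≠ μ}) ⊕ Fin 1 → ℂ =>
        c.toFun fun j => y (Sum.inr j)) (curvePoint c x t) :=
      AnalyticAt.fun_comp (g := c.toFun) hc (CGerm.analyticAt_right _)
    exact ((ContinuousLinearMap.proj (R := ℂ)
        (φ := fun _ : (Fin n ⊕ {ν : Mon n d // ν ≠ μ}) ⊕ Fin 1 => ℂ)
          (Sum.inl (Sum.inr ν))).analyticAt _).sub ((analyticAt_pi_iff.1 h1) ν)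

/-- The fibre at `q` of the induced family is the germ of the hypersurface with the equation
`c t`. -/
noncomputable def fibreIso {q : (Fin n ⊕ {ν : Mon n d // ν ≠ μ}) ⊕ Fin 1 → ℂ}
    (hq : ((H.inducedFamily z i hi hz μ hμ).pullback c).total.Contains q)
    (hφ : AnalyticAt ℂ ((H.inducedFamily z i hi hz μ hμ).pullback c).proj.toFun q)
    {f : (Fin n → ℂ) → ℂ} {a : ℂ} (ha : a ≠ 0)
    (hfa : ∀ x, f x = a * MvPolynomial.eval (i.insertNth (α := fun _ => ℂ) 1 x)
      (polyOfCoords μ (c.toFun fun j => q (Sum.inr j))))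
    (hf : AnalyticAt ℂ f fun j => q (Sum.inl (Sum.inl j)))
    (hf0 : f (fun j => q (Sum.inl (Sum.inl j))) = 0) :
    CGerm.Iso (CGerm.hyper f (fun j => q (Sum.inl (Sum.inl j))) hf hf0)
      (((H.inducedFamily z i hi hz μ hμ).pullback c).total.fibreAt
        ((H.inducedFamily z i hi hz μ hμ).pullback c).proj.toFun q hq hφ) :=
  let Y := ((H.inducedFamily z i hi hz μ hμ).pullback c).total.fibreAt
        ((H.inducedFamily z i hi hz μ hμ).pullback c).proj.toFun q hq hφ
  let t : Fin 1 → ℂ := fun j => q (Sum.inr j)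
  have hproj : ∀ k, AnalyticAt ℂ (fun y : (Fin n ⊕ {ν : Mon n d // ν ≠ μ}) ⊕ Fin 1 → ℂ => y k) q :=
    fun k => (ContinuousLinearMap.proj (R := ℂ)
        (φ := fun _ : (Fin n ⊕ {ν : Mon n d // ν ≠ μ}) ⊕ Fin 1 => ℂ) k).analyticAt _
  -- Modulo the ideal of the fibre the parameter is the constant `t`; hence so is `c` of it, by
  -- Hadamard's lemma, and hence the coefficients, by the graph equations.
  have hT : Y.Same (fun y j => y (Sum.inr j)) fun _ => t := fun j => Y.inIdeal_eqn (Sum.inr j)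
  have hC : Y.Same (fun y => c.toFun fun j => y (Sum.inr j)) fun _ => c.toFun t :=
    hT.comp_left (CGerm.analyticAt_right _) analyticAt_const (analyticAt_curve_of_contains hq)
  have hS : Y.Same (fun y ν => y (Sum.inl (Sum.inr ν))) fun _ => c.toFun t :=
    CGerm.Same.trans (fun ν => Y.inIdeal_eqn (Sum.inl (Sum.inr ν))) hC
  { hom :=
      { toFun := fun x => curvePoint c x t
        analytic := CGerm.analyticAt_sumElim
          (CGerm.analyticAt_sumElim analyticAt_id analyticAt_const) analyticAt_const
        map_pt := (eq_curvePoint_of_contains hq).symm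
        pull := by
          rintro (((k | k) | ν) | j)
          · refine (CGerm.InIdeal.mul_left (c := fun _ => a⁻¹) analyticAt_const
              (CGerm.inIdeal_eqn (CGerm.hyper f _ hf hf0) ())).congr (.of_eq (funext fun x => ?_))
            change _ = a⁻¹ * f x
            rw [hfa, inv_mul_cancel_left₀ ha]
            rfl
          · exact k.elim
          · exact (CGerm.InIdeal.zero _).congr (.of_eq (funext fun x => sub_self _))
          · exact (CGerm.InIdeal.zero _).congr (.of_eq (funext fun x => sub_self _)) }
    inv :=
      { toFun := fun y j => y (Sum.inl (Sum.inl j))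
        analytic := analyticAt_pi_iff.2 fun j => hproj _
        map_pt := rfl
        pull := by
          intro _
          -- Freezing the coefficients at `c t` changes the equation of the total space only by an
          -- element of the ideal.
          have hpair : Y.Same
              (fun y => (Sum.elim (fun j => y (Sum.inl (Sum.inl j))) (c.toFun t) :
                Fin n ⊕ {ν : Mon n d // ν ≠ μ} → ℂ))
              (fun y j => y (Sum.inl j)) := by
            rintro (j | ν)
            · exact CGerm.Same.refl Y (fun y (j : Fin n) => y (Sum.inl (Sum.inl j))) j
            · exact hS.symm ν
          have h1 := hpair.sub_inIdeal (f := fun p => MvPolynomial.eval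
              (i.insertNth (α := fun _ => ℂ) 1 fun j => p (Sum.inl j))
              (polyOfCoords μ fun ν => p (Sum.inr ν)))
            (CGerm.analyticAt_sumElim (analyticAt_pi_iff.2 fun j => hproj _) analyticAt_const)
            (CGerm.analyticAt_left _)
            (analyticAt_eval_polyOfCoords i μ (CGerm.analyticAt_left _)
              (CGerm.analyticAt_right _))
          have h2 := h1.add (Y.inIdeal_eqn (Sum.inl (Sum.inl (Sum.inl ()))))
          refine (CGerm.InIdeal.mul_left (c := fun _ => a) analyticAt_const h2).congr
            (.of_eq (funext fun y => ?_))
          refine (hfa _).trans (congrArg (a * ·) ?_)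
          exact (sub_add_cancel _ _).symm }
    inv_hom := CGerm.Same.refl _ _
    hom_inv := by
      rintro ((j | ν) | j)
      · exact CGerm.Same.refl Y (fun y (j : Fin n) => y (Sum.inl (Sum.inl j))) j
      · exact hS.symm ν
      · exact hT.symm j }

/-- The family induced by a curve is a deformation as soon as it is flat. -/
theorem isDeformation_pullback
    (hflat : ((H.inducedFamily z i hi hz μ hμ).pullback c).proj.comorphism.Flat) :
    ((H.inducedFamily z i hi hz μ hμ).pullback c).IsDeformation := by
  set D := (H.inducedFamily z i hi hz μ hμ).pullback c
  have hc : c.toFun (fun _ => 0) = H.coords μ := c.map_pt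
  -- At the base point `fibreIso` is applied to the equation of `H` itself, whose ratio to the
  -- normalised polynomial is the coefficient at `μ`.
  refine ⟨hflat, fibreIso D.total.contains_pt D.proj.analytic hμ (fun x => ?_)
    (H.analyticAt_localEq i _) (H.localEq_coords hi hz.1), ?_⟩
  · change _ = _ * MvPolynomial.eval _ (polyOfCoords μ (c.toFun fun _ => 0))
    rw [hc, H.localEq_eq i μ hμ, mul_inv_cancel_left₀ hμ]
  · have h : (fun x => curvePoint c x fun _ => 0) = D.incl.toFun := by
      funext x
      change Sum.elim (Sum.elim x (c.toFun fun _ => 0)) (fun _ => 0) =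
        Sum.elim (Sum.elim x (H.coords μ)) 0
      rw [hc]
      rfl
    rw [← h]
    exact CGerm.Same.refl _ _

/-- `fibreIso` exhibits the fibre as a hypersurface germ in `ℂⁿ`, and `S.crit` upgrades the
isomorphism of germs to an ambient equivalence. -/
theorem analyticallyEquivalent_of_fibreHasType {t : Fin 1 → ℂ}
    {q : (Fin n ⊕ {ν : Mon n d // ν ≠ μ}) ⊕ Fin 1 → ℂ} {S : IsolatedSing n}
    (h : ((H.inducedFamily z i hi hz μ hμ).pullback c).FibreHasType t q S) :
    AnalyticallyEquivalent ((ofCoords μ (c.toFun t)).localEq i)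
      (fun j => q (Sum.inl (Sum.inl j))) S.f 0 := by
  obtain ⟨hq, hφ, rfl, ⟨e⟩⟩ := h
  obtain ⟨a, ha, hfa⟩ := exists_localEq_ofCoords i μ (c.toFun fun j => q (Sum.inr j))
  exact ((fibreIso hq hφ ha hfa (analyticAt_localEq _ i _)
    (by rw [hfa, eval_eq_zero_of_contains hq, mul_zero])).trans e).analyticallyEquivalent S.crit

theorem hasSingularityAt_of_fibreHasType {t : Fin 1 → ℂ}
    {q : (Fin n ⊕ {ν : Mon n d // ν ≠ μ}) ⊕ Fin 1 → ℂ} {S : IsolatedSing n}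
    (h : ((H.inducedFamily z i hi hz μ hμ).pullback c).FibreHasType t q S) :
    (ofCoords μ (c.toFun t)).HasSingularityAt
      (PSpace.ofCoords i fun j => q (Sum.inl (Sum.inl j))) S := by
  refine ⟨i, PSpace.rep_ofCoords_ne_zero i _, ?_⟩
  rw [PSpace.coords_ofCoords]
  exact analyticallyEquivalent_of_fibreHasType h

/-- Were the fibre regular, its equation, having zero differential, would vanish identically near
the point. -/
theorem fibreSingular_curvePoint {t : Fin 1 → ℂ} (hc : AnalyticAt ℂ c.toFun t) {w : PSpace n}
    (hw : w ∈ (ofCoords μ (c.toFun t)).singularPoints) (hwi : w.rep i ≠ 0) :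
    ((H.inducedFamily z i hi hz μ hμ).pullback c).FibreSingular t
      (curvePoint c (w.coords i) t) := by
  obtain ⟨h0, hd⟩ := (mem_singularPoints_iff _ hwi).1 hw
  obtain ⟨a, ha, hfa⟩ := exists_localEq_ofCoords i μ (c.toFun t)
  have h0' := h0
  rw [hfa] at h0'
  refine ⟨contains_curvePoint hc ((mul_eq_zero.1 h0').resolve_left ha),
    CGerm.analyticAt_right _, rfl, fun hreg => ?_⟩
  have e := fibreIso (contains_curvePoint hc ((mul_eq_zero.1 h0').resolve_left ha))
    (CGerm.analyticAt_right _) ha hfa (analyticAt_localEq _ i (w.coords i)) h0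
    (hz := hz) (hi := hi) (hμ := hμ)
  exact not_eventually_localEq_eq_zero _ i _
    (CGerm.eventually_eq_zero_of_isRegular _ h0 hd (hreg.of_iso e))

/-- Over a fixed `t` the coefficients are `c t`, so a point of the fibre is determined by its affine
coordinates. -/
theorem injective_coords_of_fibreHasType {t : Fin 1 → ℂ}
    {q : Fin m → (Fin n ⊕ {ν : Mon n d // ν ≠ μ}) ⊕ Fin 1 → ℂ} {S : Fin m → IsolatedSing n}
    (hinj : Function.Injective q)
    (h : ∀ k, ((H.inducedFamily z i hi hz μ hμ).pullback c).FibreHasType t (q k) (S k)) :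
    Function.Injective fun k j => q k (Sum.inl (Sum.inl j)) := by
  intro k l hkl
  refine hinj ?_
  have ht : ∀ k, (fun j => q k (Sum.inr j)) = t := fun k => (h k).2.2.1
  rw [eq_curvePoint_of_contains (h k).1, eq_curvePoint_of_contains (h l).1, ht k, ht l]
  exact congrArg (fun x => curvePoint c x t) hkl

theorem preimage_coords_mem_nhds {U : Set (Fin n → ℂ)} (hU : U ∈ 𝓝 (z.coords i)) :
    {q : (Fin n ⊕ {ν : Mon n d // ν ≠ μ}) ⊕ Fin 1 → ℂ | (fun j => q (Sum.inl (Sum.inl j))) ∈ U} ∈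
      𝓝 ((H.inducedFamily z i hi hz μ hμ).pullback c).total.pt := by
  have hcont : Continuous fun (q : (Fin n ⊕ {ν : Mon n d // ν ≠ μ}) ⊕ Fin 1 → ℂ) (j : Fin n) =>
      q (Sum.inl (Sum.inl j)) := by fun_prop
  exact hcont.continuousAt.preimage_mem_nhds hU

theorem curveIncludes_of_includes {S : Fin m → IsolatedSing n}
    (h : ((H.inducedFamily z i hi hz μ hμ).pullback c).Includes S) :
    CurveIncludes μ c.toFun i (z.coords i) S := by
  intro U hU
  refine (h _ (preimage_coords_mem_nhds hU)).mono ?_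
  rintro t ⟨q, hinj, hq⟩
  exact ⟨fun k j => q k (Sum.inl (Sum.inl j)), injective_coords_of_fibreHasType hinj fun k => (hq k).2,
    fun k => ⟨(hq k).1, hasSingularityAt_of_fibreHasType (hq k).2⟩⟩

/-- A product neighbourhood gives one `W` for all small `t`, as needed for
`eventually_singularPoints_mem`. -/
theorem eventually_curvePoint_mem {V : Set ((Fin n ⊕ {ν : Mon n d // ν ≠ μ}) ⊕ Fin 1 → ℂ)}
    (hV : V ∈ 𝓝 ((H.inducedFamily z i hi hz μ hμ).pullback c).total.pt) :
    ∃ W ∈ 𝓝 (z.coords i), ∀ᶠ t in 𝓝 (0 : Fin 1 → ℂ), ∀ x ∈ W, curvePoint c x t ∈ V := by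
  have hc : ContinuousAt c.toFun 0 := c.analytic.continuousAt
  have hc0 : c.toFun 0 = H.coords μ := c.map_pt
  have hcont : ContinuousAt (fun y : (Fin n → ℂ) × (Fin 1 → ℂ) => curvePoint c y.1 y.2)
      (z.coords i, 0) := by
    have hc' : ContinuousAt (fun y : (Fin n → ℂ) × (Fin 1 → ℂ) => c.toFun y.2)
        (z.coords i, 0) :=
      ContinuousAt.comp (g := c.toFun) (f := Prod.snd) (x := (z.coords i, 0)) hc continuousAt_snd
    refine continuousAt_pi.2 ?_
    rintro ((j | ν) | j)
    · exact ((continuous_apply j).comp continuous_fst).continuousAt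
    · exact (continuousAt_pi.1 hc') ν
    · exact ((continuous_apply j).comp continuous_snd).continuousAt
  have hpt : curvePoint c (z.coords i) 0 =
      ((H.inducedFamily z i hi hz μ hμ).pullback c).total.pt := by
    change Sum.elim (Sum.elim (z.coords i) (c.toFun 0)) 0 =
      Sum.elim (Sum.elim (z.coords i) (H.coords μ)) 0
    rw [hc0]
  have hmem := hcont.preimage_mem_nhds (t := V) (by rw [hpt]; exact hV)
  obtain ⟨W, hW, T, hT, hWT⟩ := mem_nhds_prod_iff.1 hmem
  exact ⟨W, hW, Filter.mem_of_superset hT fun t ht x hx => hWT (Set.mk_mem_prod hx ht)⟩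

/-- `IncludesOnly` controls singular points in `V` alone. For small `t` every singular point of `c
t` in `ℙⁿ` lies in the chart and in `W`, hence gives a point of `V`. The converse inclusion holds
because analytic equivalence preserves singularity. -/
theorem curveIncludesOnly_of_includesOnly (huniq : ∀ w ∈ H.singularPoints, w = z)
    {S : Fin m → IsolatedSing n}
    (h : ((H.inducedFamily z i hi hz μ hμ).pullback c).IncludesOnly S) :
    CurveIncludesOnly μ c.toFun i (z.coords i) S := by
  intro U hU
  obtain ⟨V, hV, hVU, hfreq⟩ := h _ (preimage_coords_mem_nhds hU)
  obtain ⟨W, hW, hWV⟩ := eventually_curvePoint_mem hV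
  have hsing := c.tendsto.eventually (H.eventually_singularPoints_mem z huniq i hi μ hμ hW)
  have hev := (hWV.and (hsing.and c.analytic.eventually_analyticAt)).filter_mono
    (nhdsWithin_le_nhds (s := {(0 : Fin 1 → ℂ)}ᶜ))
  refine (hfreq.and_eventually hev).mono ?_
  rintro t ⟨⟨q, hinj, hq, honly⟩, hWV, hsing, hct⟩
  refine ⟨fun k j => q k (Sum.inl (Sum.inl j)), injective_coords_of_fibreHasType hinj fun k => (hq k).2,
    fun k => ⟨hVU (hq k).1, hasSingularityAt_of_fibreHasType (hq k).2⟩, ?_⟩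
  refine Set.Subset.antisymm (fun w hw => ?_) ?_
  · obtain ⟨hwi, hwW⟩ := hsing w hw
    obtain ⟨k, hk⟩ := honly _ (hWV _ hwW) (fibreSingular_curvePoint hct hw hwi)
    refine ⟨k, ?_⟩
    change PSpace.ofCoords i (fun j => q k (Sum.inl (Sum.inl j))) = w
    rw [hk]
    exact PSpace.ofCoords_coords hwi
  · rintro _ ⟨k, rfl⟩
    refine (mem_singularPoints_iff _ (PSpace.rep_ofCoords_ne_zero i _)).2 ?_
    rw [PSpace.coords_ofCoords]
    exact (analyticallyEquivalent_of_fibreHasType (hq k).2).singular (S k).analytic (S k).vanish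
      (S k).crit

end Fibres

end LinSys

/-! ### Realisation of singularities by curves in the linear system -/

theorem proposition3p8 {n d : ℕ} (H : LinSys n d) (z : PSpace n)
    (hz : z ∈ H.singularPoints) (huniq : ∀ w ∈ H.singularPoints, w = z)
    (i : Fin (n + 1)) (hi : z.rep i ≠ 0)
    (μ : Mon n d) (hμ : H.equation.coeff μ.1 ≠ 0)
    (hcomplete : (H.inducedFamily z i hi hz μ hμ).IsOneComplete)
    {m : ℕ} (S : Fin m → IsolatedSing n) :
    ((∃ (N : ℕ) (E : CGerm.Family (H.germ z i hi hz) CGerm.line (Fin N)),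
        E.IsDeformation ∧ E.Includes S) →
      ∃ c : CGerm.Hom CGerm.line (H.baseGerm μ),
        ((H.inducedFamily z i hi hz μ hμ).pullback c).IsDeformation ∧
        ((H.inducedFamily z i hi hz μ hμ).pullback c).Includes S ∧
        LinSys.CurveIncludes μ c.toFun i (z.coords i) S) ∧
    ((∃ (N : ℕ) (E : CGerm.Family (H.germ z i hi hz) CGerm.line (Fin N)),
        E.IsDeformation ∧ E.IncludesOnly S) →
      ∃ c : CGerm.Hom CGerm.line (H.baseGerm μ),
        ((H.inducedFamily z i hi hz μ hμ).pullback c).IsDeformation ∧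
        ((H.inducedFamily z i hi hz μ hμ).pullback c).IncludesOnly S ∧
        LinSys.CurveIncludesOnly μ c.toFun i (z.coords i) S) := by
  constructor
  · rintro ⟨N, E, hE, hS⟩
    obtain ⟨c, hc⟩ := hcomplete N E hE
    have hinc := hS.of_isomorphic hc
    exact ⟨c, LinSys.isDeformation_pullback (hc.flat hE.1), hinc,
      LinSys.curveIncludes_of_includes hinc⟩
  · rintro ⟨N, E, hE, hS⟩
    obtain ⟨c, hc⟩ := hcomplete N E hE
    have hinc := hS.of_isomorphic hc
    exact ⟨c, LinSys.isDeformation_pullback (hc.flat hE.1), hinc,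
      LinSys.curveIncludesOnly_of_includesOnly huniq hinc⟩
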